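/- \textbf{Model.} On a probability space, shocks arrive at the points $0<T_1<T_2<\cdots$ of a (non-homogeneous) Poisson process with locally integrable intensity $\lambda\ge 0$ on $[0,\infty)$; $N_t=\#\{n: T_n\le t\}$ and $\Lambda(t)=\int_0^t\lambda(x)\,dx$, with $\Lambda(t)>0$ for all $t>0$. The marks $V_n=(V_n^{(1)},V_n^{(2)})$, $n\ge1$, are i.i.d. with values in $[0,\infty)^2$ and independent of $(T_n)_{n\ge1}$; $A_t=(A_t^{(1)},A_t^{(2)})=\sum_{k=1}^{N_t}V_k$, and $\mathcal F_t=\sigma(N_s,A_s: s\le t)$. The process $(G_t)_{t\ge0}$ is nonnegative, nondecreasing and independent of $(T_n,V_n)_{n\ge1}$; $F_{G_t}$ is the distribution function of $G_t$. Let $h\ge0$ be locally integrable on $[0,\infty)$, $H(t)=\int_0^t h(s)\,ds$, let $q:[0,\infty)\to[0,1]$ be measurable, and let $L\in\mathbb R$. Three lifetimes with values in $[0,\infty]$ are considered: \begin{itemize} \item $\tau_1$ (sudden failure of the first component) has conditional hazard rate $h(t)+A^{(1)}_t$: $\mathbb P(\tau_1>t\mid\mathcal F_t)=\exp\bigl(-\int_0^t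 (h(s)+A^{(1)}_s)\,ds\bigr)$ a.s. for all $t\ge0$; \item $\tau_2=\inf\{t\ge0: G_t+A^{(2)}_t>L\}$ (the deterioration of the second component exceeds the threshold $L$); \item $\tau_3$ is the time of the first fatal shock, where, conditionally on the shock environment, a shock at time $u$ is non fatal with probability $q(u)$ independently of the other shocks: $\mathbb P(\tau_3>t\mid\mathcal F_t)=\prod_{i=1}^{N_t}q(T_i)$ a.s. for all $t\ge0$. \end{itemize} For each $t\ge 0$ the events $\{\tau_1>t\},\{\tau_2>t\},\{\tau_3>t\}$ satisfy $\mathbb P(\tau_1>t,\tau_2>t,\tau_3>t\mid\mathcal F_t)=\prod_{i=1}^3\mathbb P(\tau_i>t\mid\mathcal F_t)$ a.s. The system lifetime is $\tau=\min(\tau_1,\tau_2,\tau_3)$. A random variable $Z$ with values in $[0,\infty]$ is New Better than Used (NBU) if $\mathbb P(Z>s+t)\le\mathbb P(Z>s)\,\mathbb P(Z>t)$ for all $s,t\ge0$. \textbf{Theorem.} Assume that the intrinsic lifetimes of both components are NBU, which means that \begin{align*} e^{-H(s+t)}&\le e^{-H(s)}e^{-H(t)}, && s,t\ge0,\\ F_{G_{t+s}}(l)&\le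 F_{G_t}(l)\,F_{G_s}(l), && l,s,t\ge0, \end{align*} where the second condition holds as soon as $(G_t)_{t\ge0}$ is a nonnegative real-valued L\'evy process. Then $\tau$ is NBU if one of the two following conditions is satisfied: \begin{enumerate} \item $q$ is nonincreasing and $\lambda$ is constant; \item $q$ is constant and $\Lambda$ is superadditive: $\Lambda(x+y)\ge\Lambda(x)+\Lambda(y)$ for all $x,y\ge0$. \end{enumerate} -/

import Mathlib

open MeasureTheory ProbabilityTheory Filter Topology
open scoped NNReal ENNReal

noncomputable section

namespace ShockSystem

/-- The cumulated rate `t ↦ ∫₀ᵗ f(x) dx` of a rate function `f`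
(`H` for `f = h`, and `Λ` for `f = λ`). -/
def cumul (f : ℝ → ℝ) (t : ℝ) : ℝ := ∫ x in (0 : ℝ)..t, f x

/-- A lifetime `Z` (possibly infinite) is New Better than Used:
`ℙ(Z > s + t) ≤ ℙ(Z > s) ℙ(Z > t)` for all `s, t ≥ 0`. -/
def IsNBU {Ω : Type*} [MeasurableSpace Ω] (Z : Ω → ℝ≥0∞) (P : Measure Ω) : Prop :=
  ∀ s t : ℝ≥0, P {ω | (s : ℝ≥0∞) + t < Z ω} ≤ P {ω | (s : ℝ≥0∞) < Z ω} * P {ω | (t : ℝ≥0∞) < Z ω}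

/-- NBU property of the intrinsic lifetime of the first component, with hazard rate `h`. -/
def IntrinsicNBU₁ (h : ℝ → ℝ) : Prop :=
  ∀ s t : ℝ, 0 ≤ s → 0 ≤ t →
    Real.exp (-cumul h (s + t)) ≤ Real.exp (-cumul h s) * Real.exp (-cumul h t)

/-- NBU property of the intrinsic lifetime of the second component, with deterioration
process `G`: `F_{G_{t+s}}(l) ≤ F_{G_t}(l) F_{G_s}(l)` for all `l, s, t ≥ 0`. -/
def IntrinsicNBU₂ {Ω : Type*} [MeasurableSpace Ω] (G : ℝ≥0 → Ω → ℝ) (P : Measure Ω) : Prop :=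
  ∀ (l : ℝ) (s t : ℝ≥0), 0 ≤ l →
    cdf (P.map (G (t + s))) l ≤ cdf (P.map (G t)) l * cdf (P.map (G s)) l

/-- A real-valued Lévy process: it starts from `0`, it has independent and stationary increments
and it is continuous in probability. Regularity of the paths is not needed, and not required. -/
structure IsLevyProcess {Ω : Type*} [MeasurableSpace Ω] (G : ℝ≥0 → Ω → ℝ) (P : Measure Ω) :
    Prop where
  measurable : ∀ t, Measurable (G t)
  zero : ∀ᵐ ω ∂P, G 0 ω = 0
  indep_increments : HasIndepIncrements G P
  stationary_increments : ∀ s t, IdentDistrib (fun ω ↦ G (s + t) ω - G s ω) (G t) P P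
  continuous_in_probability : ∀ t, TendstoInMeasure P G (𝓝 t) (G t)

/-- The random objects of the model. Shocks are numbered from `0`:
`T n`, `V n` and `fatal n` refer to the `(n+1)`-st shock. -/
structure Objects (Ω : Type*) where
  /-- arrival times of the shocks -/
  T : ℕ → Ω → ℝ
  /-- increments (of the hazard rate of the first component, of the deterioration of the second
  one) due to the shocks -/
  V : ℕ → Ω → ℝ × ℝ
  /-- intrinsic deterioration of the second component -/
  G : ℝ≥0 → Ω → ℝ
  /-- the event that a shock is fatal to the system -/
  fatal : ℕ → Set Ω
  /-- lifetime of the first component under the external environment -/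
  τ₁ : Ω → ℝ≥0∞

namespace Objects

variable {Ω : Type*} (S : Objects Ω)

/-- The number `N_t` of shocks on `[0, t]`. -/
def N (t : ℝ) (ω : Ω) : ℕ := {n : ℕ | S.T n ω ≤ t}.ncard

/-- The bivariate compound process `A_t = ∑_{k ≤ N_t} V_k`. -/
def A (t : ℝ) (ω : Ω) : ℝ × ℝ := ∑ k ∈ Finset.range (S.N t ω), S.V k ω

/-- The conditional hazard rate of the first component. -/
def X₁ (h : ℝ → ℝ) (t : ℝ) (ω : Ω) : ℝ := h t + (S.A t ω).1

/-- The deterioration level of the second component. -/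
def X₂ (t : ℝ≥0) (ω : Ω) : ℝ := S.G t ω + (S.A t ω).2

/-- The lifetime of the second component: it fails once its deterioration level
exceeds the threshold `L`. -/
def τ₂ (L : ℝ) (ω : Ω) : ℝ≥0∞ := ⨅ (t : ℝ≥0) (_ : L < S.X₂ t ω), (t : ℝ≥0∞)

/-- The time of the first fatal shock. -/
def τ₃ (ω : Ω) : ℝ≥0∞ := ⨅ (n : ℕ) (_ : ω ∈ S.fatal n), ENNReal.ofReal (S.T n ω)

/-- The lifetime of the system. -/
def τ (L : ℝ) (ω : Ω) : ℝ≥0∞ := min (S.τ₁ ω) (min (S.τ₂ L ω) (S.τ₃ ω))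

/-- The history `ℱ_t` of the shocks environment (shocks and increments) up to time `t`. -/
def history (t : ℝ≥0) : MeasurableSpace Ω :=
  ⨆ (s : ℝ≥0) (_ : s ≤ t),
    MeasurableSpace.comap (fun ω ↦ (S.N s ω, S.A s ω)) inferInstance

variable [MeasurableSpace Ω]

/-- The shocks arrive according to a Poisson process with intensity `lam(t) dt`. -/
structure IsPoisson (P : Measure Ω) (lam : ℝ → ℝ) : Prop where
  measurable : ∀ n, Measurable (S.T n)
  pos : ∀ᵐ ω ∂P, ∀ n, 0 < S.T n ω
  strictMono : ∀ᵐ ω ∂P, StrictMono fun n ↦ S.T n ω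
  locally_finite : ∀ᵐ ω ∂P, Tendsto (fun n ↦ S.T n ω) atTop atTop
  indep_increments : HasIndepIncrements (fun (t : ℝ≥0) ω ↦ S.N t ω) P
  law_increments : ∀ s t : ℝ≥0, s ≤ t →
    HasLaw (fun ω ↦ S.N t ω - S.N s ω) (poissonMeasure (cumul lam t - cumul lam s).toNNReal) P

/-- The shock model with intrinsic hazard rate `h`, shock intensity `lam`, probability `q t` for a
shock at time `t` to be non fatal, and failure threshold `L`. -/
structure IsModel (P : Measure Ω) (h lam q : ℝ → ℝ) (L : ℝ) : Prop where
  h_nonneg : ∀ t, 0 ≤ t → 0 ≤ h t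
  h_integrable : ∀ t, 0 ≤ t → IntervalIntegrable h volume 0 t
  lam_nonneg : ∀ t, 0 ≤ t → 0 ≤ lam t
  lam_integrable : ∀ t, 0 ≤ t → IntervalIntegrable lam volume 0 t
  cumul_lam_pos : ∀ t, 0 < t → 0 < cumul lam t
  q_measurable : Measurable q
  q_mem : ∀ t, 0 ≤ t → q t ∈ Set.Icc (0 : ℝ) 1
  /-- shock arrivals -/
  poisson : S.IsPoisson P lam
  /-- increments: nonnegative, i.i.d., independent of the arrival times -/
  V_measurable : ∀ n, Measurable (S.V n)
  V_nonneg : ∀ n, ∀ᵐ ω ∂P, 0 ≤ (S.V n ω).1 ∧ 0 ≤ (S.V n ω).2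
  V_indep : iIndepFun S.V P
  V_identDistrib : ∀ n, IdentDistrib (S.V n) (S.V 0) P P
  V_indep_T : IndepFun (fun ω n ↦ S.V n ω) (fun ω n ↦ S.T n ω) P
  /-- intrinsic deterioration: a nonnegative nondecreasing process, independent of the shocks
  environment -/
  G_measurable : ∀ t, Measurable (S.G t)
  G_nonneg : ∀ᵐ ω ∂P, ∀ t, 0 ≤ S.G t ω
  G_monotone : ∀ᵐ ω ∂P, Monotone fun t ↦ S.G t ω
  G_indep : IndepFun (fun ω t ↦ S.G t ω) (fun ω n ↦ (S.T n ω, S.V n ω)) P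
  /-- `X₁` is the conditional hazard rate of the first component -/
  τ₁_measurable : Measurable S.τ₁
  τ₁_law : ∀ t : ℝ≥0, P⟦{ω | (t : ℝ≥0∞) < S.τ₁ ω} | S.history t⟧ =ᵐ[P]
    fun ω ↦ Real.exp (-∫ s in (0 : ℝ)..t, S.X₁ h s ω)
  /-- given the history, the Bernoulli trials are independent and a shock at time `u` is non fatal
  with probability `q u` -/
  fatal_measurable : ∀ n, MeasurableSet (S.fatal n)
  τ₃_law : ∀ t : ℝ≥0, P⟦{ω | (t : ℝ≥0∞) < S.τ₃ ω} | S.history t⟧ =ᵐ[P]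
    fun ω ↦ ∏ i ∈ Finset.range (S.N t ω), q (S.T i ω)
  /-- conditional independence of the three failure modes given the history -/
  cond_indep : ∀ t : ℝ≥0,
    P⟦{ω | (t : ℝ≥0∞) < S.τ₁ ω ∧ (t : ℝ≥0∞) < S.τ₂ L ω ∧ (t : ℝ≥0∞) < S.τ₃ ω} | S.history t⟧
      =ᵐ[P] P⟦{ω | (t : ℝ≥0∞) < S.τ₁ ω} | S.history t⟧
        * P⟦{ω | (t : ℝ≥0∞) < S.τ₂ L ω} | S.history t⟧
        * P⟦{ω | (t : ℝ≥0∞) < S.τ₃ ω} | S.history t⟧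

end Objects

end ShockSystem

end

/-!
Given that `n` shocks occur before `s`, survival until `s + t` splits into survival of the first
`n` shocks until `s` and survival, until `t`, of the later shocks seen from `s`, because the two
intrinsic lifetimes are NBU. The later shocks form a Poisson process independent of the past, with
cumulated intensity `u ↦ Λ(s + u) - Λ(s)`. If `Λ` is superadditive, this is `Λ ∘ v` for a monotone
`v` with `u ≤ v u ≤ s + u`, so that the later shocks have the same law as the original ones run
through the time change `v`: the shock at time `x` is moved to a time `y` in `[x - s, x]`. The moved
shock occurs earlier, which increases the damage it causes before `t`, and, `q` being
nonincreasing, its chance `q (s + y)` of not being fatal at the true time `s + y` is at most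
`q x`. Hence the second factor is at most the probability of surviving `t` from the start.
-/

namespace ShockSystem

section Deterioration

variable {Ω : Type*} [MeasurableSpace Ω] {P : Measure Ω} [IsProbabilityMeasure P]

theorem cdf_map_le_mul_iff {X Y Z : Ω → ℝ} (hX : Measurable X) (hY : Measurable Y)
    (hZ : Measurable Z) (l : ℝ) :
    cdf (P.map X) l ≤ cdf (P.map Y) l * cdf (P.map Z) l ↔
      P {ω | X ω ≤ l} ≤ P {ω | Y ω ≤ l} * P {ω | Z ω ≤ l} := by
  have (W : Ω → ℝ) (hW : Measurable W) : cdf (P.map W) l = (P {ω | W ω ≤ l}).toReal := by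
    have := Measure.isProbabilityMeasure_map (μ := P) hW.aemeasurable
    rw [cdf_eq_real, measureReal_def, Measure.map_apply hW measurableSet_Iic]
    rfl
  rw [this X hX, this Y hY, this Z hZ, ← ENNReal.toReal_mul,
    ENNReal.toReal_le_toReal (by finiteness) (by finiteness)]

theorem IsLevyProcess.intrinsicNBU₂ {G : ℝ≥0 → Ω → ℝ} (hG : IsLevyProcess G P)
    (hG_nonneg : ∀ t, ∀ᵐ ω ∂P, 0 ≤ G t ω) : IntrinsicNBU₂ G P := by
  intro l s t _
  rw [cdf_map_le_mul_iff (hG.measurable _) (hG.measurable _) (hG.measurable _)]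
  have hstat := hG.stationary_increments t s
  have hincr : ∀ᵐ ω ∂P, 0 ≤ G (t + s) ω - G t ω :=
    hstat.symm.ae_snd (p := fun x ↦ 0 ≤ x) measurableSet_Ici (hG_nonneg s)
  have hindep : G t ⟂ᵢ[P] (G (t + s) - G t) :=
    hG.indep_increments.indepFun_eval_sub zero_le le_self_add hG.zero
  calc P {ω | G (t + s) ω ≤ l}
      ≤ P (G t ⁻¹' Set.Iic l ∩ (G (t + s) - G t) ⁻¹' Set.Iic l) := by
        refine measure_mono_ae ?_
        filter_upwards [hincr, hG_nonneg t] with ω hinc hnonneg (hle : G (t + s) ω ≤ l)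
        exact ⟨show G t ω ≤ l by linarith, show G (t + s) ω - G t ω ≤ l by linarith⟩
    _ = P (G t ⁻¹' Set.Iic l) * P ((G (t + s) - G t) ⁻¹' Set.Iic l) :=
        hindep.measure_inter_preimage_eq_mul _ _ measurableSet_Iic measurableSet_Iic
    _ = P {ω | G t ω ≤ l} * P {ω | G s ω ≤ l} := by
        congr 1
        exact hstat.measure_mem_eq measurableSet_Iic

end Deterioration

section Independence

variable {Ω ι E F F' : Type*} [MeasurableSpace E] [MeasurableSpace F] [MeasurableSpace F']

theorem measurable_iSup_comap (X : ι → Ω → E) {S : Set ι} {i : ι} (hi : i ∈ S) :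
    Measurable[⨆ j ∈ S, MeasurableSpace.comap (X j) inferInstance] (X i) :=
  (comap_measurable (X i)).mono (le_iSup₂_of_le i hi le_rfl) le_rfl

theorem measurable_sum_iSup_comap [AddCommMonoid E] [MeasurableAdd₂ E]
    (X : ι → Ω → E) {S : Set ι} {s : Finset ι} (hs : ↑s ⊆ S) :
    Measurable[⨆ j ∈ S, MeasurableSpace.comap (X j) inferInstance] fun ω ↦ ∑ i ∈ s, X i ω :=
  Finset.measurable_fun_sum s fun _ hi ↦ measurable_iSup_comap X (hs hi)

variable [MeasurableSpace Ω] {P : Measure Ω}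

theorem indepFun_of_measurable_iSup_comap {X : ι → Ω → E} (hX : ∀ i, Measurable (X i))
    (hindep : iIndepFun X P) {S T : Set ι} (hST : Disjoint S T) {Y : Ω → F} {Z : Ω → F'}
    (hY : Measurable[⨆ i ∈ S, MeasurableSpace.comap (X i) inferInstance] Y)
    (hZ : Measurable[⨆ i ∈ T, MeasurableSpace.comap (X i) inferInstance] Z) :
    Y ⟂ᵢ[P] Z := by
  have h := indep_iSup_of_disjoint (fun i ↦ (hX i).comap_le) hindep.iIndep hST
  exact (IndepFun_iff_Indep Y Z P).2
    (indep_of_indep_of_le_left (indep_of_indep_of_le_right h hZ.comap_le) hY.comap_le)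

theorem lintegral_comp_prodMk_of_indepFun [IsFiniteMeasure P] {X : Ω → E} {Y : Ω → F}
    (hX : AEMeasurable X P) (hY : AEMeasurable Y P) (hXY : X ⟂ᵢ[P] Y)
    {f : E × F → ℝ≥0∞} (hf : Measurable f) :
    ∫⁻ ω, f (X ω, Y ω) ∂P = ∫⁻ ω, ∫⁻ ω', f (X ω, Y ω') ∂P ∂P := by
  rw [← lintegral_map' hf.aemeasurable (hX.prodMk hY),
    (indepFun_iff_map_prod_eq_prod_map_map hX hY).1 hXY, lintegral_prod _ hf.aemeasurable,
    lintegral_map' hf.lintegral_prod_right'.aemeasurable hX]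
  refine lintegral_congr fun ω ↦ ?_
  exact lintegral_map' (hf.comp measurable_prodMk_left).aemeasurable hY

end Independence

section IndependentIncrements

variable {Ω T E : Type*} [MeasurableSpace Ω] {P : Measure Ω} [LinearOrder T] [OrderBot T]
  [MeasurableSpace E] [AddCommGroup E] [MeasurableAdd₂ E] [MeasurableSub₂ E]

theorem exists_monotone_seq_cover (I : Finset T) :
    ∃ t : ℕ → T, Monotone t ∧ t 0 = ⊥ ∧ ∀ u ∈ I, ∃ n, t n = u := by
  obtain ⟨n, hn⟩ : ∃ n, (insert ⊥ I).card = n + 1 :=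
    Nat.exists_eq_succ_of_ne_zero (Finset.card_ne_zero.2 ⟨⊥, Finset.mem_insert_self _ _⟩)
  let e := (insert ⊥ I).orderEmbOfFin hn
  let t (k : ℕ) : T := e ⟨min k n, by omega⟩
  have hmono : Monotone t := fun a b hab ↦
    e.monotone (by simp only [Fin.mk_le_mk]; omega)
  have hcover : ∀ u ∈ insert ⊥ I, ∃ k, t k = u := by
    intro u hu
    obtain ⟨i, rfl⟩ : u ∈ Set.range e := by rwa [Finset.range_orderEmbOfFin]
    exact ⟨i, congrArg e (Fin.ext (min_eq_left (Nat.lt_succ_iff.1 i.2)))⟩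
  obtain ⟨k, hk⟩ := hcover ⊥ (Finset.mem_insert_self _ _)
  exact ⟨t, hmono, bot_unique ((hmono k.zero_le).trans hk.le),
    fun u hu ↦ hcover u (Finset.mem_insert_of_mem hu)⟩

theorem identDistrib_of_hasIndepIncrements {X Y : T → Ω → E}
    (hXm : ∀ t, Measurable (X t)) (hYm : ∀ t, Measurable (Y t))
    (hX : HasIndepIncrements X P) (hY : HasIndepIncrements Y P)
    (hlaw : ∀ s t, s ≤ t →
      IdentDistrib (fun ω ↦ X t ω - X s ω) (fun ω ↦ Y t ω - Y s ω) P P) :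
    IdentDistrib (fun ω t ↦ X t ω - X ⊥ ω) (fun ω t ↦ Y t ω - Y ⊥ ω) P P := by
  have : IsProbabilityMeasure P := (hX 0 (fun _ ↦ ⊥) fun _ _ _ ↦ le_rfl).isProbabilityMeasure
  rw [identDistrib_iff_forall_finset_identDistrib (X := fun t ω ↦ X t ω - X ⊥ ω)
    (Y := fun t ω ↦ Y t ω - Y ⊥ ω)
    (measurable_pi_lambda _ fun t ↦ (hXm t).sub (hXm ⊥)).aemeasurable
    (measurable_pi_lambda _ fun t ↦ (hYm t).sub (hYm ⊥)).aemeasurable]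
  intro I
  obtain ⟨t, ht, ht0, hcover⟩ := exists_monotone_seq_cover I
  choose! k hk using hcover
  have hincr : IdentDistrib (fun ω j ↦ X (t (j + 1)) ω - X (t j) ω)
      (fun ω j ↦ Y (t (j + 1)) ω - Y (t j) ω) P P := by
    refine ⟨by fun_prop, by fun_prop, ?_⟩
    rw [(hX.nat ht).map_fun_eq_infinitePi_map (fun j ↦ by fun_prop),
      (hY.nat ht).map_fun_eq_infinitePi_map (fun j ↦ by fun_prop)]
    congr 1
    exact funext fun j ↦ (hlaw _ _ (ht (Nat.le_succ j))).map_eq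
  let partialSums (d : ℕ → E) (u : I) : E := ∑ j ∈ Finset.range (k u), d j
  have hsum (f : T → E) : I.restrict (fun u ↦ f u - f ⊥) =
      partialSums fun j ↦ f (t (j + 1)) - f (t j) := by
    ext u
    simp only [Finset.restrict, partialSums]
    rw [Finset.sum_range_sub (fun j ↦ f (t j)), hk u u.2, ht0]
  simp only [hsum]
  exact hincr.comp (u := partialSums) (by fun_prop)

theorem indepFun_stopped_future_of_hasIndepIncrements {X : T → Ω → E}
    (hXm : ∀ t, Measurable (X t)) (hX : HasIndepIncrements X P) (s : T) :
    (fun ω t ↦ X (min t s) ω - X ⊥ ω) ⟂ᵢ[P] (fun ω t ↦ X (max t s) ω - X s ω) := by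
  have : IsProbabilityMeasure P := (hX 0 (fun _ ↦ ⊥) fun _ _ _ ↦ le_rfl).isProbabilityMeasure
  refine IndepFun.process_indepFun_process (X := fun t ω ↦ X (min t s) ω - X ⊥ ω)
    (Y := fun t ω ↦ X (max t s) ω - X s ω) (fun t ↦ (hXm _).sub (hXm _))
    (fun t ↦ (hXm _).sub (hXm _)) fun I J ↦ ?_
  obtain ⟨t, ht, ht0, hcover⟩ := exists_monotone_seq_cover
    (insert s (I.image (min · s) ∪ J.image (max · s)))
  obtain ⟨m, hm⟩ := hcover s (by simp)
  let D (j : ℕ) (ω : Ω) : E := X (t (j + 1)) ω - X (t j) ω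
  have hpast (u : I) : ∃ k ≤ m, t k = min u.1 s := by
    obtain ⟨k, hk⟩ := hcover (min u s) <| Finset.mem_insert_of_mem <|
      Finset.mem_union_left _ (Finset.mem_image_of_mem _ u.2)
    exact ⟨min k m, min_le_right _ _, by rw [ht.map_min, hk, hm, min_assoc, min_self]⟩
  have hfuture (u : J) : ∃ k, m ≤ k ∧ t k = max u.1 s := by
    obtain ⟨k, hk⟩ := hcover (max u s) <| Finset.mem_insert_of_mem <|
      Finset.mem_union_right _ (Finset.mem_image_of_mem _ u.2)
    exact ⟨max k m, le_max_right _ _, by rw [ht.map_max, hk, hm, max_assoc, max_self]⟩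
  refine indepFun_of_measurable_iSup_comap (X := D) (fun j ↦ (hXm _).sub (hXm _)) (hX.nat ht)
    (S := Set.Iio m) (T := Set.Ici m) (Set.disjoint_left.2 fun j hj ↦ not_le.2 (Set.mem_Iio.1 hj))
    (@measurable_pi_lambda _ _ _ (_) _ _ fun u ↦ ?_)
    (@measurable_pi_lambda _ _ _ (_) _ _ fun u ↦ ?_)
  · obtain ⟨k, hkm, hk⟩ := hpast u
    have hsum (ω : Ω) : X (min u s) ω - X ⊥ ω = ∑ j ∈ Finset.range k, D j ω := by
      rw [Finset.sum_range_sub (fun j ↦ X (t j) ω), hk, ht0]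
    simp only [hsum]
    exact measurable_sum_iSup_comap D fun j hj ↦
      (Finset.mem_range.1 (Finset.mem_coe.1 hj)).trans_le hkm
  · obtain ⟨k, hmk, hk⟩ := hfuture u
    have hsum (ω : Ω) : X (max u s) ω - X s ω = ∑ j ∈ Finset.Ico m k, D j ω := by
      rw [Finset.sum_Ico_sub (fun j ↦ X (t j) ω) hmk, hk, hm]
    simp only [hsum]
    exact measurable_sum_iSup_comap D fun j hj ↦ (Finset.mem_Ico.1 (Finset.mem_coe.1 hj)).1

end IndependentIncrements

section IndependentSequences

variable {Ω E : Type*} [MeasurableSpace Ω] {P : Measure Ω} [MeasurableSpace E] {V : ℕ → Ω → E}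

theorem identDistrib_tail_of_iIndepFun (hVm : ∀ i, Measurable (V i)) (hV : iIndepFun V P)
    (hlaw : ∀ i, IdentDistrib (V i) (V 0) P P) (n : ℕ) :
    IdentDistrib (fun ω i ↦ V (n + i) ω) (fun ω i ↦ V i ω) P P := by
  refine ⟨by fun_prop, by fun_prop, ?_⟩
  rw [(hV.precomp (add_right_injective n)).map_fun_eq_infinitePi_map fun i ↦ hVm _,
    hV.map_fun_eq_infinitePi_map hVm]
  congr 1
  exact funext fun i ↦ (hlaw (n + i)).map_eq.trans (hlaw i).map_eq.symm

theorem lintegral_mul_comp_tail_of_iIndepFun (hVm : ∀ i, Measurable (V i)) (hV : iIndepFun V P)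
    (hlaw : ∀ i, IdentDistrib (V i) (V 0) P P) {n : ℕ} {f g : (ℕ → E) → ℝ≥0∞} (hf : Measurable f)
    (hg : Measurable g) (hf_congr : ∀ v v', (∀ i < n, v i = v' i) → f v = f v') :
    ∫⁻ ω, f (V · ω) * g (fun i ↦ V (n + i) ω) ∂P =
      (∫⁻ ω, f (V · ω) ∂P) * ∫⁻ ω, g (V · ω) ∂P := by
  have : IsProbabilityMeasure P := hV.isProbabilityMeasure
  obtain ⟨c⟩ : Nonempty E := (nonempty_of_isProbabilityMeasure P).map (V 0)
  have hf_initial : f ∘ (fun ω i ↦ V i ω) = f ∘ fun ω i ↦ if i < n then V i ω else c :=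
    funext fun ω ↦ hf_congr _ _ fun i hi ↦ (if_pos hi).symm
  have hinitial : Measurable[⨆ i ∈ Set.Iio n, MeasurableSpace.comap (V i) inferInstance]
      fun ω i ↦ if i < n then V i ω else c := by
    refine @measurable_pi_lambda _ _ _ (_) _ _ fun i ↦ ?_
    by_cases hi : i < n
    · simpa only [if_pos hi] using measurable_iSup_comap V (Set.mem_Iio.2 hi)
    · simpa only [if_neg hi] using @measurable_const _ _ _ (_) c
  have htail : Measurable[⨆ i ∈ Set.Ici n, MeasurableSpace.comap (V i) inferInstance]
      fun ω i ↦ V (n + i) ω :=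
    @measurable_pi_lambda _ _ _ (_) _ _ fun i ↦ measurable_iSup_comap V (Nat.le_add_right n i)
  have hindep : (f ∘ fun ω i ↦ V i ω) ⟂ᵢ[P] (g ∘ fun ω i ↦ V (n + i) ω) :=
    indepFun_of_measurable_iSup_comap hVm hV (S := Set.Iio n) (T := Set.Ici n)
      (Set.disjoint_left.2 fun i hi ↦ not_le.2 (Set.mem_Iio.1 hi))
      (hf_initial ▸ hf.comp hinitial) (hg.comp htail)
  calc ∫⁻ ω, f (V · ω) * g (fun i ↦ V (n + i) ω) ∂P
      = (∫⁻ ω, f (V · ω) ∂P) * ∫⁻ ω, g (fun i ↦ V (n + i) ω) ∂P :=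
        lintegral_mul_eq_lintegral_mul_lintegral_of_indepFun (hf.comp (by fun_prop))
          (hg.comp (by fun_prop)) hindep
    _ = (∫⁻ ω, f (V · ω) ∂P) * ∫⁻ ω, g (V · ω) ∂P := by
        congr 1
        exact ((identDistrib_tail_of_iIndepFun hVm hV hlaw n).comp hg).lintegral_eq

theorem measurable_comp_add {D : Type*} [MeasurableSpace D] {ν : D → ℕ} (hν : Measurable ν) :
    Measurable fun p : D × (ℕ → E) ↦ fun i ↦ p.2 (ν p.1 + i) := by
  have h (i : ℕ) : Measurable fun p : (ℕ → E) × ℕ ↦ p.1 (p.2 + i) :=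
    measurable_from_prod_countable_left fun n ↦ measurable_pi_apply (n + i)
  exact measurable_pi_lambda _ fun i ↦
    (h i).comp (measurable_snd.prodMk (hν.comp measurable_fst))

theorem lintegral_mul_comp_random_tail_of_iIndepFun (hVm : ∀ i, Measurable (V i))
    (hV : iIndepFun V P) (hlaw : ∀ i, IdentDistrib (V i) (V 0) P P) {D : Type*}
    [MeasurableSpace D] {W : Ω → D} (hWm : Measurable W) (hWV : W ⟂ᵢ[P] fun ω i ↦ V i ω)
    {ν : D → ℕ} (hν : Measurable ν) {f g : D → (ℕ → E) → ℝ≥0∞}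
    (hf : Measurable (Function.uncurry f)) (hg : Measurable (Function.uncurry g))
    (hf_congr : ∀ d v v', (∀ i < ν d, v i = v' i) → f d v = f d v') :
    ∫⁻ ω, f (W ω) (V · ω) * g (W ω) (fun i ↦ V (ν (W ω) + i) ω) ∂P =
      ∫⁻ ω, (∫⁻ ω', f (W ω) (V · ω') ∂P) * ∫⁻ ω', g (W ω) (V · ω') ∂P ∂P := by
  have : IsProbabilityMeasure P := hV.isProbabilityMeasure
  have hmeas : Measurable fun p : D × (ℕ → E) ↦ f p.1 p.2 * g p.1 fun i ↦ p.2 (ν p.1 + i) :=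
    hf.mul (hg.comp (measurable_fst.prodMk (measurable_comp_add hν)))
  rw [lintegral_comp_prodMk_of_indepFun (Y := fun ω i ↦ V i ω) hWm.aemeasurable (by fun_prop) hWV
    hmeas]
  exact lintegral_congr fun ω ↦ lintegral_mul_comp_tail_of_iIndepFun hVm hV hlaw
    (hf.comp measurable_prodMk_left) (hg.comp measurable_prodMk_left) (hf_congr (W ω))

end IndependentSequences

section CountingPaths

theorem lt_ncard_setOf_le_iff {α : Type*} [Preorder α] {x : ℕ → α} (hx : Monotone x) {t : α}
    (hfin : {n | x n ≤ t}.Finite) {i : ℕ} : i < {n | x n ≤ t}.ncard ↔ x i ≤ t := by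
  refine ⟨fun hi ↦ ?_, fun hi ↦ ?_⟩
  · by_contra hxi
    have hsub : {n | x n ≤ t} ⊆ Finset.range i := fun n (hn : x n ≤ t) ↦
      Finset.mem_coe.2 <| Finset.mem_range.2 <| lt_of_not_ge fun hin ↦ hxi ((hx hin).trans hn)
    have := Set.ncard_le_ncard hsub
    rw [Set.ncard_coe_finset, Finset.card_range] at this
    omega
  · have hsub : ↑(Finset.range (i + 1)) ⊆ {n | x n ≤ t} := fun n hn ↦
      (hx (Nat.lt_succ_iff.1 (Finset.mem_range.1 (Finset.mem_coe.1 hn)))).trans hi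
    have := Set.ncard_le_ncard hsub hfin
    rw [Set.ncard_coe_finset, Finset.card_range] at this
    omega

/-- The jump times of a counting path `M`: the `i`-th one is the first time at which `M` exceeds
`i`. Restricting to rational times makes it a measurable function of `M`; the value is `0` if `M`
never exceeds `i`. -/
noncomputable def pathPoints (M : ℝ≥0 → ℤ) (i : ℕ) : ℝ :=
  (⨅ r : ℚ, if i < M (Real.toNNReal r) then (Real.toNNReal r : ℝ≥0∞) else ⊤).toReal

@[fun_prop]
theorem measurable_pathPoints : Measurable pathPoints := by
  refine measurable_pi_lambda _ fun i ↦ Measurable.ennreal_toReal (Measurable.iInf fun r ↦ ?_)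
  exact Measurable.ite (measurableSet_lt measurable_const (measurable_pi_apply _))
    measurable_const measurable_const

theorem pathPoints_mem_Icc {M : ℝ≥0 → ℤ} {i : ℕ} {a b : ℝ} (hb : 0 ≤ b)
    (hlower : ∀ r : ℝ≥0, i < M r → a ≤ r) (hupper : ∀ r : ℝ≥0, b ≤ r → i < M r) :
    pathPoints M i ∈ Set.Icc a b := by
  have hle : (⨅ r : ℚ, if i < M (Real.toNNReal r) then (Real.toNNReal r : ℝ≥0∞) else ⊤)
      ≤ ENNReal.ofReal b := by
    refine le_of_forall_gt fun c hc ↦ ?_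
    obtain ⟨r, -, hbr, hrc⟩ := ENNReal.lt_iff_exists_rat_btwn.1 hc
    have hb_le : b ≤ Real.toNNReal r := by
      simpa using (ENNReal.ofReal_le_iff_le_toReal ENNReal.coe_ne_top).1 hbr.le
    exact (iInf_le _ r).trans_lt (by rwa [if_pos (hupper _ hb_le)])
  refine ⟨?_, ENNReal.toReal_le_of_le_ofReal hb hle⟩
  refine (ENNReal.ofReal_le_iff_le_toReal (ne_top_of_le_ne_top ENNReal.ofReal_ne_top hle)).1 ?_
  refine le_iInf fun r ↦ ?_
  split_ifs with hr
  · exact ENNReal.ofReal_le_of_le_toReal (hlower _ hr)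
  · exact le_top

theorem pathPoints_eq {M : ℝ≥0 → ℤ} {i : ℕ} {a : ℝ} (ha : 0 ≤ a)
    (h : ∀ r : ℝ≥0, i < M r ↔ a ≤ r) : pathPoints M i = a := by
  obtain ⟨hle, hge⟩ := pathPoints_mem_Icc ha (fun r ↦ (h r).1) fun r ↦ (h r).2
  exact le_antisymm hge hle

theorem pathPoints_le {M : ℝ≥0 → ℤ} (hM : Monotone M) {i : ℕ} {t : ℝ≥0} (h : i < M t) :
    pathPoints M i ≤ t :=
  (pathPoints_mem_Icc (a := 0) t.coe_nonneg (fun r _ ↦ r.coe_nonneg)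
    fun _ hr ↦ h.trans_le (hM (NNReal.coe_le_coe.1 hr))).2

end CountingPaths

section Arrivals

variable {Ω : Type*} [MeasurableSpace Ω] {P : Measure Ω} {S : Objects Ω} {lam : ℝ → ℝ}

theorem measurable_ncard_setOf_le (t : ℝ) : Measurable fun x : ℕ → ℝ ↦ {n | x n ≤ t}.ncard :=
  measurable_ncard.comp <| measurable_set_iff.2 fun n ↦
    measurableSet_setOfPred.1 (measurableSet_le (measurable_pi_apply n) measurable_const)

theorem measurable_N (hT : ∀ n, Measurable (S.T n)) (t : ℝ) : Measurable (S.N t) :=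
  (measurable_ncard_setOf_le t).comp (measurable_pi_lambda _ hT)

namespace Objects.IsPoisson

theorem ae_lt_N_iff (hS : S.IsPoisson P lam) :
    ∀ᵐ ω ∂P, ∀ (t : ℝ) (i : ℕ), i < S.N t ω ↔ S.T i ω ≤ t := by
  filter_upwards [hS.strictMono, hS.locally_finite] with ω hmono hlim t i
  refine lt_ncard_setOf_le_iff hmono.monotone ?_
  have hlarge := hlim.eventually_gt_atTop t
  rw [← Nat.cofinite_eq_atTop, eventually_cofinite] at hlarge
  simpa only [not_lt] using hlarge

theorem ae_monotone_N (hS : S.IsPoisson P lam) : ∀ᵐ ω ∂P, Monotone fun t ↦ S.N t ω := by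
  filter_upwards [hS.ae_lt_N_iff] with ω hN s t hst
  exact le_of_forall_lt fun i hi ↦ (hN t i).2 (((hN s i).1 hi).trans hst)

theorem ae_N_zero (hS : S.IsPoisson P lam) : ∀ᵐ ω ∂P, S.N 0 ω = 0 := by
  filter_upwards [hS.ae_lt_N_iff, hS.pos] with ω hN hpos
  exact Nat.eq_zero_of_not_pos fun h ↦ (hpos 0).not_ge ((hN 0 0).1 h)

end Objects.IsPoisson

end Arrivals

section SurvivalFunctional

/-- The conditional probability, given `n` shocks at times `x i` with marks `v i` on `[0, t]`, that
the system survives until `t` when the first component has no intrinsic hazard rate: no failure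
caused by the induced hazard rate, no fatal shock, and no excess of deterioration, `K a` being the
probability that a cumulated deterioration `a` due to the shocks is not too large. -/
noncomputable def shockSurvival (q : ℝ → ℝ) (K : ℝ → ℝ≥0∞) (t : ℝ) (n : ℕ) (x : ℕ → ℝ)
    (v : ℕ → ℝ × ℝ) : ℝ≥0∞ :=
  ENNReal.ofReal (Real.exp (-∑ i ∈ Finset.range n, (v i).1 * (t - x i))) *
    (∏ i ∈ Finset.range n, ENNReal.ofReal (q (x i))) * K (∑ i ∈ Finset.range n, (v i).2)

theorem measurable_shockSurvival {α : Type*} [MeasurableSpace α] {q : ℝ → ℝ} (hq : Measurable q)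
    {K : ℝ → ℝ≥0∞} (hK : Measurable K) (t : ℝ) {ν : α → ℕ} (hν : Measurable ν) {x : α → ℕ → ℝ}
    (hx : Measurable x) {v : α → ℕ → ℝ × ℝ} (hv : Measurable v) :
    Measurable fun a ↦ shockSurvival q K t (ν a) (x a) (v a) := by
  have hprod : Measurable fun p : ℕ × (ℕ → ℝ) × (ℕ → ℝ × ℝ) ↦
      shockSurvival q K t p.1 p.2.1 p.2.2 := by
    refine measurable_from_prod_countable_right fun n ↦ ?_
    simp only [shockSurvival]
    fun_prop
  simpa only [Function.comp_def] using hprod.comp (hν.prodMk (hx.prodMk hv))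

variable {q : ℝ → ℝ} {K : ℝ → ℝ≥0∞} {n m : ℕ} {x y : ℕ → ℝ} {v w : ℕ → ℝ × ℝ}

theorem shockSurvival_congr (t : ℝ) (hx : ∀ i < n, x i = y i) (hv : ∀ i < n, v i = w i) :
    shockSurvival q K t n x v = shockSurvival q K t n y w := by
  unfold shockSurvival
  congr 1
  · congr 1
    · refine congrArg (fun z ↦ ENNReal.ofReal (Real.exp (-z))) (Finset.sum_congr rfl fun i hi ↦ ?_)
      rw [hx i (Finset.mem_range.1 hi), hv i (Finset.mem_range.1 hi)]
    · exact Finset.prod_congr rfl fun i hi ↦ by rw [hx i (Finset.mem_range.1 hi)]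
  · exact congrArg K (Finset.sum_congr rfl fun i hi ↦ by rw [hv i (Finset.mem_range.1 hi)])

theorem shockSurvival_le_of_earlier {q' : ℝ → ℝ} {t : ℝ} (hmn : m ≤ n)
    (hxy : ∀ i < m, x i ≤ y i) (hxt : ∀ i < n, x i ≤ t) (hq : ∀ i < n, q (x i) ≤ 1)
    (hqq' : ∀ i < m, q (x i) ≤ q' (y i)) (hv : ∀ i, 0 ≤ v i) (hK : Antitone K) :
    shockSurvival q K t n x v ≤ shockSurvival q' K t m y v := by
  have hsub : Finset.range m ⊆ Finset.range n := Finset.range_subset_range.2 hmn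
  refine mul_le_mul' (mul_le_mul' ?_ ?_) (hK ?_)
  · refine ENNReal.ofReal_le_ofReal (Real.exp_le_exp.2 (neg_le_neg ?_))
    calc ∑ i ∈ Finset.range m, (v i).1 * (t - y i)
        ≤ ∑ i ∈ Finset.range m, (v i).1 * (t - x i) := Finset.sum_le_sum fun i hi ↦
          mul_le_mul_of_nonneg_left (sub_le_sub_left (hxy i (Finset.mem_range.1 hi)) t) (hv i).1
      _ ≤ ∑ i ∈ Finset.range n, (v i).1 * (t - x i) :=
          Finset.sum_le_sum_of_subset_of_nonneg hsub fun i hi _ ↦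
            mul_nonneg (hv i).1 (sub_nonneg.2 (hxt i (Finset.mem_range.1 hi)))
  · calc ∏ i ∈ Finset.range n, ENNReal.ofReal (q (x i))
        ≤ ∏ i ∈ Finset.range m, ENNReal.ofReal (q (x i)) :=
          Finset.prod_le_prod_of_subset_of_le_one' hsub fun i hi _ ↦
            ENNReal.ofReal_le_one.2 (hq i (Finset.mem_range.1 hi))
      _ ≤ ∏ i ∈ Finset.range m, ENNReal.ofReal (q' (y i)) := Finset.prod_le_prod' fun i hi ↦
          ENNReal.ofReal_le_ofReal (hqq' i (Finset.mem_range.1 hi))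
  · exact Finset.sum_le_sum_of_subset_of_nonneg hsub fun i _ _ ↦ (hv i).2

theorem shockSurvival_add_le_mul {K₁ K₂ : ℝ → ℝ≥0∞} (s : ℝ) {t : ℝ} (ht : 0 ≤ t)
    (hv : ∀ i, 0 ≤ v i) (hK : ∀ a b, 0 ≤ a → 0 ≤ b → K (a + b) ≤ K₁ a * K₂ b) :
    shockSurvival q K (s + t) (n + m) x v ≤ shockSurvival q K₁ s n x v *
      shockSurvival (fun u ↦ q (s + u)) K₂ t m (fun i ↦ x (n + i) - s) (fun i ↦ v (n + i)) := by
  have hexp : Real.exp (-∑ i ∈ Finset.range (n + m), (v i).1 * (s + t - x i)) ≤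
      Real.exp (-∑ i ∈ Finset.range n, (v i).1 * (s - x i)) *
        Real.exp (-∑ i ∈ Finset.range m, (v (n + i)).1 * (t - (x (n + i) - s))) := by
    rw [← Real.exp_add, Real.exp_le_exp, Finset.sum_range_add, ← neg_add, neg_le_neg_iff]
    refine add_le_add (Finset.sum_le_sum fun i _ ↦ ?_) (Finset.sum_le_sum fun i _ ↦ le_of_eq ?_)
    · exact mul_le_mul_of_nonneg_left (by linarith) (hv i).1
    · ring
  have hprod : ∏ i ∈ Finset.range (n + m), ENNReal.ofReal (q (x i)) =
      (∏ i ∈ Finset.range n, ENNReal.ofReal (q (x i))) *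
        ∏ i ∈ Finset.range m, ENNReal.ofReal (q (s + (x (n + i) - s))) := by
    simp only [Finset.prod_range_add, add_sub_cancel]
  have hlevel : K (∑ i ∈ Finset.range (n + m), (v i).2) ≤
      K₁ (∑ i ∈ Finset.range n, (v i).2) * K₂ (∑ i ∈ Finset.range m, (v (n + i)).2) := by
    rw [Finset.sum_range_add]
    exact hK _ _ (Finset.sum_nonneg fun i _ ↦ (hv i).2) (Finset.sum_nonneg fun i _ ↦ (hv _).2)
  calc shockSurvival q K (s + t) (n + m) x v
      ≤ ENNReal.ofReal (Real.exp (-∑ i ∈ Finset.range n, (v i).1 * (s - x i)) *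
          Real.exp (-∑ i ∈ Finset.range m, (v (n + i)).1 * (t - (x (n + i) - s)))) *
        ((∏ i ∈ Finset.range n, ENNReal.ofReal (q (x i))) *
          ∏ i ∈ Finset.range m, ENNReal.ofReal (q (s + (x (n + i) - s)))) *
        (K₁ (∑ i ∈ Finset.range n, (v i).2) * K₂ (∑ i ∈ Finset.range m, (v (n + i)).2)) := by
        rw [shockSurvival, hprod]
        exact mul_le_mul' (mul_le_mul_left (ENNReal.ofReal_le_ofReal hexp) _) hlevel
    _ = _ := by
        rw [ENNReal.ofReal_mul (Real.exp_nonneg _), shockSurvival, shockSurvival]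
        ring

end SurvivalFunctional

section TimeChange

theorem exists_monotone_timeChange {F : ℝ≥0 → ℝ} (hcont : Continuous F) (hmono : Monotone F)
    (h0 : F 0 = 0) (hsup : ∀ x y, F x + F y ≤ F (x + y)) (s : ℝ≥0) :
    ∃ v : ℝ≥0 → ℝ≥0, Monotone v ∧ v 0 = 0 ∧ (∀ u, v u ∈ Set.Icc u (s + u)) ∧
      ∀ u, F (v u) = F (s + u) - F s := by
  let A (u : ℝ≥0) : Set ℝ≥0 := {x | u ≤ x ∧ F x = F (s + u) - F s}
  have hsolution (u : ℝ≥0) : ∃ x ∈ Set.Icc u (s + u), F x = F (s + u) - F s :=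
    intermediate_value_Icc le_add_self hcont.continuousOn
      ⟨by linarith [hsup s u], by linarith [hmono (zero_le (a := s))]⟩
  have hmem (u : ℝ≥0) : sInf (A u) ∈ A u := by
    obtain ⟨x, hx, hFx⟩ := hsolution u
    exact (isClosed_Ici.inter (isClosed_eq hcont continuous_const)).csInf_mem ⟨x, hx.1, hFx⟩
      (OrderBot.bddBelow _)
  refine ⟨fun u ↦ sInf (A u), fun a b hab ↦ ?_, ?_, fun u ↦ ⟨(hmem u).1, ?_⟩, fun u ↦ (hmem u).2⟩
  · by_contra! hlt
    have hF : F (sInf (A a)) ≤ F (sInf (A b)) := by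
      rw [(hmem a).2, (hmem b).2]
      exact sub_le_sub_right (hmono (add_le_add_right hab s)) _
    have hA : sInf (A b) ∈ A a :=
      ⟨hab.trans (hmem b).1, ((hmono hlt.le).antisymm hF).trans (hmem a).2⟩
    exact (csInf_le (OrderBot.bddBelow _) hA).not_gt hlt
  · have h0A : 0 ∈ A 0 := ⟨le_rfl, by simp [h0]⟩
    exact le_antisymm (csInf_le (OrderBot.bddBelow _) h0A) zero_le
  · obtain ⟨x, hx, hFx⟩ := hsolution u
    have hxA : x ∈ A u := ⟨hx.1, hFx⟩
    exact (csInf_le (OrderBot.bddBelow _) hxA).trans hx.2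

variable {f : ℝ → ℝ}

theorem monotone_cumul_coe (hf : ∀ t, 0 ≤ t → 0 ≤ f t)
    (hint : ∀ t, 0 ≤ t → IntervalIntegrable f volume 0 t) :
    Monotone fun t : ℝ≥0 ↦ cumul f t := by
  intro a b hab
  have hincr : cumul f b - cumul f a = ∫ x in (a : ℝ)..b, f x :=
    intervalIntegral.integral_interval_sub_left (hint b b.2) (hint a a.2)
  have hnonneg : 0 ≤ ∫ x in (a : ℝ)..b, f x :=
    intervalIntegral.integral_nonneg hab fun x hx ↦ hf x (a.2.trans hx.1)
  exact sub_nonneg.1 (hnonneg.trans_eq hincr.symm)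

theorem continuous_cumul_coe (hint : ∀ t, 0 ≤ t → IntervalIntegrable f volume 0 t) :
    Continuous fun t : ℝ≥0 ↦ cumul f t := by
  refine continuous_iff_continuousAt.2 fun t ↦ ?_
  have hIcc : ContinuousOn (cumul f) (Set.Icc 0 (t + 1)) := by
    have hprim := intervalIntegral.continuousOn_primitive_interval'
      (hint (t + 1) (by positivity)) Set.left_mem_uIcc
    rwa [Set.uIcc_of_le (by positivity)] at hprim
  have hIic : ContinuousOn (fun u : ℝ≥0 ↦ cumul f u) (Set.Iic (t + 1)) :=
    hIcc.comp NNReal.continuous_coe.continuousOn fun u hu ↦ ⟨u.2, mod_cast hu⟩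
  exact hIic.continuousAt (Iic_mem_nhds (lt_add_one t))

theorem cumul_eq_const_mul {c : ℝ} (hc : ∀ t, 0 ≤ t → f t = c) {t : ℝ} (ht : 0 ≤ t) :
    cumul f t = c * t := by
  have hcongr : cumul f t = ∫ _ in (0 : ℝ)..t, c :=
    intervalIntegral.integral_congr fun x hx ↦ hc x (Set.uIcc_of_le ht ▸ hx).1
  rw [hcongr, intervalIntegral.integral_const, smul_eq_mul, sub_zero, mul_comm]

end TimeChange

section PoissonShocks

variable {Ω : Type*} [MeasurableSpace Ω] {P : Measure Ω} {S : Objects Ω} {lam : ℝ → ℝ}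

theorem hasIndepIncrements_comp_monotone {T T' E : Type*} [Preorder T] [Preorder T']
    [MeasurableSpace E] [Sub E] {X : T → Ω → E} (hX : HasIndepIncrements X P) {v : T' → T}
    (hv : Monotone v) : HasIndepIncrements (fun u ↦ X (v u)) P :=
  fun n t ht ↦ hX n (v ∘ t) (hv.comp ht)

namespace Objects.IsPoisson

theorem hasIndepIncrements_N_intCast (hS : S.IsPoisson P lam) :
    HasIndepIncrements (fun (t : ℝ≥0) ω ↦ (S.N t ω : ℤ)) P := by
  intro n t ht
  refine ((hS.indep_increments n t ht).comp (fun _ k ↦ (k : ℤ)) fun _ ↦ by fun_prop).congr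
    fun i ↦ ?_
  filter_upwards [hS.ae_monotone_N] with ω hN
  exact Nat.cast_sub (hN (NNReal.coe_le_coe.2 (ht i.castSucc_le_succ)))

theorem hasLaw_N_intCast_sub (hS : S.IsPoisson P lam) {s t : ℝ≥0} (hst : s ≤ t) :
    HasLaw (fun ω ↦ (S.N t ω : ℤ) - S.N s ω)
      ((poissonMeasure (cumul lam t - cumul lam s).toNNReal).map (Nat.cast : ℕ → ℤ)) P := by
  have hcast : HasLaw (Nat.cast : ℕ → ℤ)
      ((poissonMeasure (cumul lam t - cumul lam s).toNNReal).map (Nat.cast : ℕ → ℤ))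
      (poissonMeasure (cumul lam t - cumul lam s).toNNReal) := ⟨by fun_prop, rfl⟩
  refine (hcast.comp (hS.law_increments s t hst)).congr ?_
  filter_upwards [hS.ae_monotone_N] with ω hN
  exact (Nat.cast_sub (hN (NNReal.coe_le_coe.2 hst))).symm

theorem identDistrib_shift_timeChange (hS : S.IsPoisson P lam) {s : ℝ≥0} {v : ℝ≥0 → ℝ≥0}
    (hv : Monotone v) (hv0 : v 0 = 0)
    (hcumul : ∀ u : ℝ≥0, cumul lam (v u) = cumul lam ↑(s + u) - cumul lam s) :
    IdentDistrib (fun ω (u : ℝ≥0) ↦ (S.N ↑(s + u) ω : ℤ) - S.N s ω)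
      (fun ω u ↦ (S.N (v u) ω : ℤ)) P P := by
  have hNm (t : ℝ≥0) : Measurable fun ω ↦ (S.N t ω : ℤ) :=
    measurable_of_countable _ |>.comp (measurable_N hS.measurable t)
  have hshift : Monotone (s + · : ℝ≥0 → ℝ≥0) := fun _ _ h ↦ add_le_add_right h s
  have hident := identDistrib_of_hasIndepIncrements (fun u ↦ hNm (s + u)) (fun u ↦ hNm (v u))
    (hasIndepIncrements_comp_monotone hS.hasIndepIncrements_N_intCast hshift)
    (hasIndepIncrements_comp_monotone hS.hasIndepIncrements_N_intCast hv) fun a b hab ↦ by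
      have hlaw := hS.hasLaw_N_intCast_sub (hv hab)
      rw [hcumul, hcumul, sub_sub_sub_cancel_right] at hlaw
      exact (hS.hasLaw_N_intCast_sub (hshift hab)).identDistrib hlaw
  have hv_sub : (fun ω u ↦ (S.N (v u) ω : ℤ) - S.N (v ⊥) ω) =ᵐ[P] fun ω u ↦ (S.N (v u) ω : ℤ) := by
    filter_upwards [hS.ae_N_zero] with ω hω
    simp [hv0, hω]
  simpa only [bot_eq_zero, add_zero] using
    hident.trans (IdentDistrib.of_ae_eq hident.aemeasurable_snd hv_sub)

theorem ae_pathPoints_shift (hS : S.IsPoisson P lam) (s : ℝ≥0) :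
    ∀ᵐ ω ∂P, pathPoints (fun u ↦ (S.N ↑(s + u) ω : ℤ) - S.N s ω) =
      fun i ↦ S.T (S.N s ω + i) ω - s := by
  filter_upwards [hS.ae_lt_N_iff] with ω hN
  refine funext fun i ↦ pathPoints_eq ?_ fun r ↦ ?_
  · exact sub_nonneg.2 (not_le.1 fun h ↦ (Nat.le_add_right _ i).not_gt ((hN s _).2 h)).le
  · rw [lt_sub_iff_add_lt', sub_le_iff_le_add', ← NNReal.coe_add, ← hN, ← Nat.cast_add]
    exact Nat.cast_lt

theorem ae_pathPoints_stopped (hS : S.IsPoisson P lam) (s : ℝ≥0) :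
    ∀ᵐ ω ∂P, ∀ i < S.N s ω, pathPoints (fun u ↦ (S.N ↑(min u s) ω : ℤ) - S.N 0 ω) i = S.T i ω := by
  filter_upwards [hS.ae_lt_N_iff, hS.ae_N_zero, hS.pos] with ω hN hN0 hpos i hi
  refine pathPoints_eq (hpos i).le fun r ↦ ?_
  rw [hN0, Nat.cast_zero, sub_zero, Nat.cast_lt, hN, NNReal.coe_min, le_min_iff]
  exact and_iff_left ((hN s i).1 hi)

end Objects.IsPoisson

end PoissonShocks

section MeanSurvival

variable {Ω : Type*} [MeasurableSpace Ω] {P : Measure Ω} {V : ℕ → Ω → ℝ × ℝ}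
  {q : ℝ → ℝ} {K : ℝ → ℝ≥0∞}

/-- The conditional survival probability `shockSurvival` averaged over the marks `V`. -/
noncomputable def meanShockSurvival (P : Measure Ω) (V : ℕ → Ω → ℝ × ℝ) (q : ℝ → ℝ) (K : ℝ → ℝ≥0∞)
    (t : ℝ) (n : ℕ) (x : ℕ → ℝ) : ℝ≥0∞ :=
  ∫⁻ ω, shockSurvival q K t n x (V · ω) ∂P

theorem measurable_meanShockSurvival [SFinite P] (hV : ∀ n, Measurable (V n)) (hq : Measurable q)
    (hK : Measurable K) (t : ℝ) :
    Measurable fun p : ℕ × (ℕ → ℝ) ↦ meanShockSurvival P V q K t p.1 p.2 :=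
  Measurable.lintegral_prod_right' (ν := P) (f := fun p : (ℕ × (ℕ → ℝ)) × Ω ↦
      shockSurvival q K t p.1.1 p.1.2 (V · p.2)) <|
    measurable_shockSurvival hq hK t (by fun_prop) (by fun_prop) (by fun_prop)

theorem meanShockSurvival_congr (t : ℝ) {n : ℕ} {x y : ℕ → ℝ} (hx : ∀ i < n, x i = y i) :
    meanShockSurvival P V q K t n x = meanShockSurvival P V q K t n y :=
  lintegral_congr fun _ ↦ shockSurvival_congr t hx fun _ _ ↦ rfl

theorem meanShockSurvival_le_of_earlier (hV : ∀ᵐ ω ∂P, ∀ i, 0 ≤ V i ω) {q' : ℝ → ℝ} {t : ℝ}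
    {m n : ℕ} (hmn : m ≤ n) {x y : ℕ → ℝ} (hxy : ∀ i < m, x i ≤ y i) (hxt : ∀ i < n, x i ≤ t)
    (hq : ∀ i < n, q (x i) ≤ 1) (hqq' : ∀ i < m, q (x i) ≤ q' (y i)) (hK : Antitone K) :
    meanShockSurvival P V q K t n x ≤ meanShockSurvival P V q' K t m y :=
  lintegral_mono_ae <| hV.mono fun _ hv ↦ shockSurvival_le_of_earlier hmn hxy hxt hq hqq' hv hK

end MeanSurvival

section Restart

variable {Ω : Type*} [MeasurableSpace Ω] {P : Measure Ω} {S : Objects Ω} {h lam q : ℝ → ℝ} {L : ℝ}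

namespace Objects.IsPoisson

theorem lintegral_mul_shift (hS : S.IsPoisson P lam) (s t : ℝ≥0) {Φ Ψ : ℕ → (ℕ → ℝ) → ℝ≥0∞}
    (hΦ : Measurable (Function.uncurry Φ)) (hΨ : Measurable (Function.uncurry Ψ))
    (hΦ_congr : ∀ n x y, (∀ i < n, x i = y i) → Φ n x = Φ n y) :
    ∫⁻ ω, Φ (S.N s ω) (S.T · ω) *
        Ψ (S.N ↑(s + t) ω - S.N s ω) (fun i ↦ S.T (S.N s ω + i) ω - s) ∂P =
      (∫⁻ ω, Φ (S.N s ω) (S.T · ω) ∂P) *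
        ∫⁻ ω, Ψ (S.N ↑(s + t) ω - S.N s ω) (fun i ↦ S.T (S.N s ω + i) ω - s) ∂P := by
  have hNm (u : ℝ≥0) : Measurable fun ω ↦ (S.N u ω : ℤ) :=
    (measurable_of_countable _).comp (measurable_N hS.measurable u)
  let past (ω : Ω) (u : ℝ≥0) : ℤ := S.N ↑(min u s) ω - S.N ↑(⊥ : ℝ≥0) ω
  let future (ω : Ω) (u : ℝ≥0) : ℤ := S.N ↑(max u s) ω - S.N s ω
  have hindep : past ⟂ᵢ[P] future :=
    indepFun_stopped_future_of_hasIndepIncrements hNm hS.hasIndepIncrements_N_intCast s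
  let φ (M : ℝ≥0 → ℤ) : ℝ≥0∞ := Φ (M s).toNat (pathPoints M)
  let ψ (M : ℝ≥0 → ℤ) : ℝ≥0∞ := Ψ (M (s + t)).toNat (pathPoints fun u ↦ M (s + u))
  have hφ : Measurable φ := hΦ.comp <| (by fun_prop : Measurable fun M : ℝ≥0 → ℤ ↦
    ((M s).toNat, pathPoints M))
  have hψ : Measurable ψ := hΨ.comp <| (by fun_prop : Measurable fun M : ℝ≥0 → ℤ ↦
    ((M (s + t)).toNat, pathPoints fun u ↦ M (s + u)))
  have hpast : ∀ᵐ ω ∂P, φ (past ω) = Φ (S.N s ω) (S.T · ω) := by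
    filter_upwards [hS.ae_N_zero, hS.ae_pathPoints_stopped s] with ω hN0 hpoints
    have hNs : (past ω s).toNat = S.N s ω := by simp [past, hN0]
    exact (congrArg (Φ · _) hNs).trans (hΦ_congr _ _ _ hpoints)
  have hfuture : ∀ᵐ ω ∂P, ψ (future ω) =
      Ψ (S.N ↑(s + t) ω - S.N s ω) (fun i ↦ S.T (S.N s ω + i) ω - s) := by
    filter_upwards [hS.ae_pathPoints_shift s] with ω hpoints
    have hshift (u : ℝ≥0) : future ω (s + u) = S.N ↑(s + u) ω - S.N s ω := by
      simp only [future, max_eq_left (le_self_add : s ≤ s + u)]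
    simp only [ψ, hshift, hpoints, Int.toNat_sub]
  rw [← lintegral_congr_ae hpast, ← lintegral_congr_ae hfuture]
  refine Eq.trans (lintegral_congr_ae (EventuallyEq.mul hpast hfuture).symm) ?_
  exact lintegral_mul_eq_lintegral_mul_lintegral_of_indepFun (hφ.comp (by fun_prop))
    (hψ.comp (by fun_prop)) (hindep.comp hφ hψ)

theorem lintegral_shift_eq_timeChange (hS : S.IsPoisson P lam) {s : ℝ≥0} (t : ℝ≥0)
    {v : ℝ≥0 → ℝ≥0} (hv : Monotone v) (hv0 : v 0 = 0)
    (hcumul : ∀ u : ℝ≥0, cumul lam (v u) = cumul lam ↑(s + u) - cumul lam s)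
    {Ψ : ℕ → (ℕ → ℝ) → ℝ≥0∞} (hΨ : Measurable (Function.uncurry Ψ)) :
    ∫⁻ ω, Ψ (S.N ↑(s + t) ω - S.N s ω) (fun i ↦ S.T (S.N s ω + i) ω - s) ∂P =
      ∫⁻ ω, Ψ (S.N (v t) ω) (pathPoints fun u ↦ (S.N (v u) ω : ℤ)) ∂P := by
  have hψ : Measurable fun M : ℝ≥0 → ℤ ↦ Ψ (M t).toNat (pathPoints M) :=
    hΨ.comp (by fun_prop : Measurable fun M : ℝ≥0 → ℤ ↦ ((M t).toNat, pathPoints M))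
  refine Eq.trans (lintegral_congr_ae ?_)
    ((hS.identDistrib_shift_timeChange hv hv0 hcumul).comp hψ).lintegral_eq
  filter_upwards [hS.ae_pathPoints_shift s] with ω hpoints
  simp only [Function.comp_apply, hpoints, Int.toNat_sub]

theorem ae_pathPoints_timeChange_mem_Icc (hS : S.IsPoisson P lam) {s : ℝ≥0} {v : ℝ≥0 → ℝ≥0}
    (hv : ∀ u, v u ∈ Set.Icc u (s + u)) : ∀ᵐ ω ∂P, ∀ i,
      pathPoints (fun u ↦ (S.N (v u) ω : ℤ)) i ∈ Set.Icc (S.T i ω - s) (S.T i ω) := by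
  filter_upwards [hS.ae_lt_N_iff, hS.pos] with ω hN hpos i
  refine pathPoints_mem_Icc (hpos i).le (fun r hr ↦ ?_) fun r hr ↦ ?_
  · exact sub_le_iff_le_add'.2 (((hN _ _).1 (Nat.cast_lt.1 hr)).trans (hv r).2)
  · exact Nat.cast_lt.2 ((hN _ _).2 (hr.trans (hv r).1))

end Objects.IsPoisson

namespace Objects.IsModel

theorem isProbabilityMeasure (hS : S.IsModel P h lam q L) : IsProbabilityMeasure P :=
  hS.V_indep.isProbabilityMeasure

theorem ae_V_nonneg (hS : S.IsModel P h lam q L) : ∀ᵐ ω ∂P, ∀ n, 0 ≤ S.V n ω :=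
  ae_all_iff.2 hS.V_nonneg

variable {K K₁ K₂ : ℝ → ℝ≥0∞}

theorem lintegral_shockSurvival_eq (hS : S.IsModel P h lam q L) (hK : Measurable K) (t : ℝ) :
    ∫⁻ ω, shockSurvival q K t (S.N t ω) (S.T · ω) (S.V · ω) ∂P =
      ∫⁻ ω, meanShockSurvival P S.V q K t (S.N t ω) (S.T · ω) ∂P := by
  have := hS.isProbabilityMeasure
  have hTm := hS.poisson.measurable
  have hVm := hS.V_measurable
  have hf : Measurable fun p : (ℕ → ℝ) × (ℕ → ℝ × ℝ) ↦
      shockSurvival q K t {n | p.1 n ≤ t}.ncard p.1 p.2 :=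
    measurable_shockSurvival hS.q_measurable hK t
      ((measurable_ncard_setOf_le t).comp measurable_fst) measurable_fst measurable_snd
  exact lintegral_comp_prodMk_of_indepFun (by fun_prop) (by fun_prop) hS.V_indep_T.symm hf

theorem lintegral_shockSurvival_add_le (hS : S.IsModel P h lam q L) (hK₁ : Measurable K₁)
    (hK₂ : Measurable K₂) (hK : ∀ a b, 0 ≤ a → 0 ≤ b → K (a + b) ≤ K₁ a * K₂ b) (s t : ℝ≥0) :
    ∫⁻ ω, shockSurvival q K ↑(s + t) (S.N ↑(s + t) ω) (S.T · ω) (S.V · ω) ∂P ≤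
      ∫⁻ ω, meanShockSurvival P S.V q K₁ s (S.N s ω) (S.T · ω) *
        meanShockSurvival P S.V (fun u ↦ q (s + u)) K₂ t (S.N ↑(s + t) ω - S.N s ω)
          (fun i ↦ S.T (S.N s ω + i) ω - s) ∂P := by
  let ν (r : ℝ) (x : ℕ → ℝ) : ℕ := {n | x n ≤ r}.ncard
  have hν (r : ℝ) : Measurable (ν r) := measurable_ncard_setOf_le r
  let f (x : ℕ → ℝ) (v : ℕ → ℝ × ℝ) : ℝ≥0∞ := shockSurvival q K₁ s (ν s x) x v
  let g (x : ℕ → ℝ) (v : ℕ → ℝ × ℝ) : ℝ≥0∞ := shockSurvival (fun u ↦ q (s + u)) K₂ t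
    (ν ↑(s + t) x - ν s x) (fun i ↦ x (ν s x + i) - s) v
  have hf : Measurable (Function.uncurry f) :=
    measurable_shockSurvival hS.q_measurable hK₁ s ((hν s).comp measurable_fst) measurable_fst
      measurable_snd
  have hfuture : Measurable fun x : ℕ → ℝ ↦ fun i ↦ x (ν s x + i) - s :=
    ((measurable_comp_add (hν s)).comp (measurable_id.prodMk measurable_id)).sub_const fun _ ↦ s
  have hg : Measurable (Function.uncurry g) :=
    measurable_shockSurvival (hS.q_measurable.comp (measurable_const_add _)) hK₂ t
      (((hν _).sub (hν s)).comp measurable_fst) (hfuture.comp measurable_fst) measurable_snd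
  refine (lintegral_mono_ae ?_).trans_eq <| lintegral_mul_comp_random_tail_of_iIndepFun
    hS.V_measurable hS.V_indep hS.V_identDistrib (measurable_pi_lambda _ hS.poisson.measurable)
    hS.V_indep_T.symm (hν s) hf hg fun _ _ _ ↦ shockSurvival_congr _ fun _ _ ↦ rfl
  filter_upwards [hS.ae_V_nonneg, hS.poisson.ae_monotone_N] with ω hv hN
  have hN_add : S.N s ω + (S.N ↑(s + t) ω - S.N s ω) = S.N ↑(s + t) ω :=
    Nat.add_sub_cancel' (hN (NNReal.coe_le_coe.2 le_self_add))
  calc shockSurvival q K ↑(s + t) (S.N ↑(s + t) ω) (S.T · ω) (S.V · ω)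
      = shockSurvival q K (s + t) (S.N s ω + (S.N ↑(s + t) ω - S.N s ω)) (S.T · ω) (S.V · ω) := by
        rw [hN_add, NNReal.coe_add]
    _ ≤ _ := shockSurvival_add_le_mul s t.coe_nonneg hv hK

theorem lintegral_timeChange_le (hS : S.IsModel P h lam q L) (hq : AntitoneOn q (Set.Ici 0))
    (hK : Antitone K) {s : ℝ≥0} (t : ℝ≥0) {v : ℝ≥0 → ℝ≥0} (hv : Monotone v)
    (hv_mem : ∀ u, v u ∈ Set.Icc u (s + u)) :
    ∫⁻ ω, meanShockSurvival P S.V (fun u ↦ q (s + u)) K t (S.N (v t) ω)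
        (pathPoints fun u ↦ (S.N (v u) ω : ℤ)) ∂P ≤
      ∫⁻ ω, meanShockSurvival P S.V q K t (S.N t ω) (S.T · ω) ∂P := by
  refine lintegral_mono_ae ?_
  filter_upwards [hS.poisson.ae_pathPoints_timeChange_mem_Icc hv_mem, hS.poisson.ae_monotone_N,
    hS.poisson.pos] with ω hmem hN hpos
  set y := pathPoints fun u ↦ (S.N (v u) ω : ℤ)
  have hT_le (i : ℕ) : S.T i ω ≤ s + y i := sub_le_iff_le_add'.1 (hmem i).1
  have hpath : Monotone fun u ↦ (S.N (v u) ω : ℤ) :=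
    fun _ _ hab ↦ Nat.cast_le.2 (hN (NNReal.coe_le_coe.2 (hv hab)))
  refine meanShockSurvival_le_of_earlier hS.ae_V_nonneg
    (hN (NNReal.coe_le_coe.2 (hv_mem t).1)) (fun i _ ↦ (hmem i).2)
    (fun i hi ↦ pathPoints_le hpath (Nat.cast_lt.2 hi)) (fun i _ ↦ ?_) (fun i _ ↦ ?_) hK
  · exact (hS.q_mem _ ((hpos i).le.trans (hT_le i))).2
  · exact hq (hpos i).le ((hpos i).le.trans (hT_le i)) (hT_le i)

theorem lintegral_shockSurvival_add_le_mul (hS : S.IsModel P h lam q L)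
    (hq : AntitoneOn q (Set.Ici 0))
    (hlam : ∀ x y, 0 ≤ x → 0 ≤ y → cumul lam x + cumul lam y ≤ cumul lam (x + y))
    (hK₁ : Antitone K₁) (hK₂ : Antitone K₂)
    (hK : ∀ a b, 0 ≤ a → 0 ≤ b → K (a + b) ≤ K₁ a * K₂ b) (s t : ℝ≥0) :
    ∫⁻ ω, shockSurvival q K ↑(s + t) (S.N ↑(s + t) ω) (S.T · ω) (S.V · ω) ∂P ≤
      (∫⁻ ω, shockSurvival q K₁ s (S.N s ω) (S.T · ω) (S.V · ω) ∂P) *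
        ∫⁻ ω, shockSurvival q K₂ t (S.N t ω) (S.T · ω) (S.V · ω) ∂P := by
  have := hS.isProbabilityMeasure
  obtain ⟨v, hv, hv0, hv_mem, hv_cumul⟩ := exists_monotone_timeChange
    (continuous_cumul_coe hS.lam_integrable) (monotone_cumul_coe hS.lam_nonneg hS.lam_integrable)
    (by simp [cumul]) (fun x y ↦ by simpa using hlam x y x.2 y.2) s
  have hmean₂ : Measurable (Function.uncurry
      (meanShockSurvival P S.V (fun u ↦ q (s + u)) K₂ t)) :=
    measurable_meanShockSurvival hS.V_measurable
      (hS.q_measurable.comp (measurable_const_add _)) hK₂.measurable t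
  calc _ ≤ ∫⁻ ω, meanShockSurvival P S.V q K₁ s (S.N s ω) (S.T · ω) *
        meanShockSurvival P S.V (fun u ↦ q (s + u)) K₂ t (S.N ↑(s + t) ω - S.N s ω)
          (fun i ↦ S.T (S.N s ω + i) ω - s) ∂P :=
        hS.lintegral_shockSurvival_add_le hK₁.measurable hK₂.measurable hK s t
    _ = (∫⁻ ω, meanShockSurvival P S.V q K₁ s (S.N s ω) (S.T · ω) ∂P) *
        ∫⁻ ω, meanShockSurvival P S.V (fun u ↦ q (s + u)) K₂ t (S.N ↑(s + t) ω - S.N s ω)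
          (fun i ↦ S.T (S.N s ω + i) ω - s) ∂P :=
        hS.poisson.lintegral_mul_shift s t
          (measurable_meanShockSurvival hS.V_measurable hS.q_measurable hK₁.measurable s) hmean₂
          fun _ _ _ ↦ meanShockSurvival_congr _
    _ ≤ (∫⁻ ω, meanShockSurvival P S.V q K₁ s (S.N s ω) (S.T · ω) ∂P) *
        ∫⁻ ω, meanShockSurvival P S.V q K₂ t (S.N t ω) (S.T · ω) ∂P := by
        rw [hS.poisson.lintegral_shift_eq_timeChange t hv hv0 hv_cumul hmean₂]
        exact mul_le_mul_right (hS.lintegral_timeChange_le hq hK₂ t hv hv_mem) _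
    _ = _ := by rw [hS.lintegral_shockSurvival_eq hK₁.measurable,
        hS.lintegral_shockSurvival_eq hK₂.measurable]

end Objects.IsModel

end Restart

section LevelSurvival

variable {Ω : Type*} [MeasurableSpace Ω] {P : Measure Ω} {G : ℝ≥0 → Ω → ℝ}

/-- The probability that the process `G` is still at most `l` at some time after `t`, the times
`t + 1 / (n + 1)` being sufficient to detect this for a monotone process. It is used instead of
`P {ω | G t ω ≤ l}` because the paths of `G` need not be right-continuous: a lifetime defined as
an infimum exceeds `t` if and only if the threshold is not crossed slightly beyond `t`. -/
noncomputable def levelSurvival (P : Measure Ω) (G : ℝ≥0 → Ω → ℝ) (t : ℝ≥0) (l : ℝ) : ℝ≥0∞ :=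
  P {ω | ∃ n : ℕ, G (t + 1 / ((n : ℝ≥0) + 1)) ω ≤ l}

theorem monotone_levelSurvival (t : ℝ≥0) : Monotone (levelSurvival P G t) :=
  fun _ _ hab ↦ measure_mono fun _ ⟨n, hn⟩ ↦ ⟨n, hn.trans hab⟩

theorem levelSurvival_eq_zero (hG : ∀ᵐ ω ∂P, ∀ t, 0 ≤ G t ω) (t : ℝ≥0) {l : ℝ} (hl : l < 0) :
    levelSurvival P G t l = 0 := by
  refine measure_eq_zero_iff_ae_notMem.2 ?_
  filter_upwards [hG] with ω hω
  rintro ⟨n, hn⟩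
  exact (hω _).not_gt (hn.trans_lt hl)

theorem levelSurvival_eq_iSup (hG : ∀ᵐ ω ∂P, Monotone fun t ↦ G t ω) (t : ℝ≥0) (l : ℝ) :
    levelSurvival P G t l = ⨆ n : ℕ, P {ω | G (t + 1 / ((n : ℝ≥0) + 1)) ω ≤ l} := by
  refine le_antisymm ?_ (iSup_le fun n ↦ measure_mono fun ω hω ↦ ⟨n, hω⟩)
  rw [levelSurvival, Set.ofPred_exists, measure_iUnion_eq_iSup_accumulate]
  refine iSup_mono fun n ↦ measure_mono_ae ?_
  filter_upwards [hG] with ω hω hmem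
  obtain ⟨k, hkn, hk⟩ := Set.mem_accumulate.1 hmem
  have hle : t + 1 / ((n : ℝ≥0) + 1) ≤ t + 1 / ((k : ℝ≥0) + 1) := by gcongr
  exact (hω hle).trans hk

theorem levelSurvival_add_le_mul [IsProbabilityMeasure P] (hG_meas : ∀ t, Measurable (G t))
    (hG_nonneg : ∀ᵐ ω ∂P, ∀ t, 0 ≤ G t ω) (hG_mono : ∀ᵐ ω ∂P, Monotone fun t ↦ G t ω)
    (hG : IntrinsicNBU₂ G P) (s t : ℝ≥0) (l : ℝ) :
    levelSurvival P G (s + t) l ≤ levelSurvival P G s l * levelSurvival P G t l := by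
  rcases lt_or_ge l 0 with hl | hl
  · simp only [levelSurvival_eq_zero hG_nonneg _ hl, zero_mul, le_refl]
  rw [levelSurvival_eq_iSup hG_mono (s + t)]
  refine iSup_le fun n ↦ ?_
  have hsplit : s + t + 1 / ((n : ℝ≥0) + 1) =
      (s + 1 / (((2 * n + 1 : ℕ) : ℝ≥0) + 1)) + (t + 1 / (((2 * n + 1 : ℕ) : ℝ≥0) + 1)) := by
    push_cast
    field_simp
    ring
  calc P {ω | G (s + t + 1 / ((n : ℝ≥0) + 1)) ω ≤ l}
      ≤ P {ω | G (s + 1 / (((2 * n + 1 : ℕ) : ℝ≥0) + 1)) ω ≤ l} *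
          P {ω | G (t + 1 / (((2 * n + 1 : ℕ) : ℝ≥0) + 1)) ω ≤ l} := by
        rw [hsplit]
        exact (cdf_map_le_mul_iff (hG_meas _) (hG_meas _) (hG_meas _) l).1 (hG l _ _ hl)
    _ ≤ levelSurvival P G s l * levelSurvival P G t l :=
        mul_le_mul' (measure_mono fun _ hω ↦ ⟨_, hω⟩) (measure_mono fun _ hω ↦ ⟨_, hω⟩)

theorem measurableSet_exists_le {α : Type*} [MeasurableSpace α] {g : ℝ≥0 → α → ℝ} {z : α → ℝ}
    (hg : ∀ t, Measurable (g t)) (hz : Measurable z) (t : ℝ≥0) :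
    MeasurableSet {a | ∃ n : ℕ, g (t + 1 / ((n : ℝ≥0) + 1)) a ≤ z a} := by
  rw [Set.ofPred_exists]
  exact MeasurableSet.iUnion fun n ↦ measurableSet_le (hg _) hz

theorem setLIntegral_exists_le_of_indepFun [IsFiniteMeasure P] (hG : ∀ t, Measurable (G t))
    {Y : Ω → ℝ≥0∞} (hY : Measurable Y) {Z : Ω → ℝ} (hZ : Measurable Z)
    (hind : (fun ω ↦ (Y ω, Z ω)) ⟂ᵢ[P] fun ω t ↦ G t ω) (t : ℝ≥0) :
    ∫⁻ ω in {ω | ∃ n : ℕ, G (t + 1 / ((n : ℝ≥0) + 1)) ω ≤ Z ω}, Y ω ∂P =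
      ∫⁻ ω, Y ω * levelSurvival P G t (Z ω) ∂P := by
  let U : Set ((ℝ≥0∞ × ℝ) × (ℝ≥0 → ℝ)) := {p | ∃ n : ℕ, p.2 (t + 1 / ((n : ℝ≥0) + 1)) ≤ p.1.2}
  have hU : MeasurableSet U :=
    measurableSet_exists_le (g := fun r (p : (ℝ≥0∞ × ℝ) × (ℝ≥0 → ℝ)) ↦ p.2 r)
      (fun r ↦ by fun_prop) (by fun_prop) t
  have hGm : Measurable fun ω t ↦ G t ω := measurable_pi_lambda _ hG
  have hUG (p : ℝ≥0∞ × ℝ) : MeasurableSet {ω' | (p, fun t ↦ G t ω') ∈ U} :=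
    (measurable_const.prodMk hGm) hU
  calc ∫⁻ ω in {ω | ∃ n : ℕ, G (t + 1 / ((n : ℝ≥0) + 1)) ω ≤ Z ω}, Y ω ∂P
      = ∫⁻ ω, U.indicator (fun p ↦ p.1.1) ((Y ω, Z ω), fun t ↦ G t ω) ∂P :=
        (lintegral_indicator (measurableSet_exists_le hG hZ t) _).symm
    _ = ∫⁻ ω, ∫⁻ ω', U.indicator (fun p ↦ p.1.1) ((Y ω, Z ω), fun t ↦ G t ω') ∂P ∂P :=
        lintegral_comp_prodMk_of_indepFun (hY.prodMk hZ).aemeasurable hGm.aemeasurable hind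
          ((measurable_fst.comp measurable_fst).indicator hU)
    _ = ∫⁻ ω, Y ω * levelSurvival P G t (Z ω) ∂P :=
        lintegral_congr fun ω ↦ lintegral_indicator_const (hUG (Y ω, Z ω)) _

end LevelSurvival

section SecondComponent

theorem tendsto_add_one_div_nat (t : ℝ≥0) :
    Tendsto (fun n : ℕ ↦ t + 1 / ((n : ℝ≥0) + 1)) atTop (𝓝 t) := by
  simpa only [add_zero] using (tendsto_one_div_add_atTop_nhds_zero_nat (𝕜 := ℝ≥0)).const_add t

theorem lt_iInf_coe_iff_of_monotone {α : Type*} [LinearOrder α] {X : ℝ≥0 → α} (hX : Monotone X)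
    (L : α) (t : ℝ≥0) : (t : ℝ≥0∞) < ⨅ (u : ℝ≥0) (_ : L < X u), (u : ℝ≥0∞) ↔
      ∃ n : ℕ, X (t + 1 / ((n : ℝ≥0) + 1)) ≤ L := by
  constructor
  · intro hlt
    obtain ⟨n, hn⟩ := ((ENNReal.tendsto_coe.2
      (tendsto_add_one_div_nat t)).eventually_lt_const hlt).exists
    exact ⟨n, le_of_not_gt fun hL ↦ hn.not_ge (biInf_le (fun u : ℝ≥0 ↦ (u : ℝ≥0∞)) hL)⟩
  · rintro ⟨n, hn⟩
    refine (ENNReal.coe_lt_coe.2 (lt_add_of_pos_right t ?_)).trans_le <|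
      le_iInf₂ fun u hu ↦ ENNReal.coe_le_coe.2 (hX.reflect_lt (hn.trans_lt hu)).le
    positivity

variable {Ω : Type*} [MeasurableSpace Ω] {P : Measure Ω} {S : Objects Ω} {h lam q : ℝ → ℝ} {L : ℝ}

theorem Objects.IsPoisson.ae_eventually_N_add_eq (hS : S.IsPoisson P lam) (t : ℝ≥0) :
    ∀ᵐ ω ∂P, ∀ᶠ n : ℕ in atTop, S.N (t + 1 / ((n : ℝ≥0) + 1) : ℝ≥0) ω = S.N t ω := by
  filter_upwards [hS.ae_lt_N_iff, hS.ae_monotone_N] with ω hN hmono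
  have hnext : (t : ℝ) < S.T (S.N t ω) ω := lt_of_not_ge fun hle ↦ lt_irrefl _ ((hN t _).2 hle)
  have hlim := (NNReal.tendsto_coe.2 (tendsto_add_one_div_nat t)).eventually_lt_const hnext
  filter_upwards [hlim] with n hn
  refine le_antisymm (le_of_not_gt fun hlt ↦ hn.not_ge ((hN _ _).1 hlt)) (hmono ?_)
  exact NNReal.coe_le_coe.2 le_self_add

namespace Objects.IsModel

theorem ae_monotone_A (hS : S.IsModel P h lam q L) : ∀ᵐ ω ∂P, Monotone fun t ↦ S.A t ω := by
  filter_upwards [hS.poisson.ae_monotone_N, hS.ae_V_nonneg] with ω hN hV s t hst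
  exact Finset.sum_le_sum_of_subset_of_nonneg (Finset.range_subset_range.2 (hN hst))
    fun i _ _ ↦ hV i

theorem lt_τ₂_ae_eq (hS : S.IsModel P h lam q L) (t : ℝ≥0) :
    ({ω | (t : ℝ≥0∞) < S.τ₂ L ω} : Set Ω) =ᵐ[P]
      {ω | ∃ n : ℕ, S.G (t + 1 / ((n : ℝ≥0) + 1)) ω ≤ L - (S.A t ω).2} := by
  filter_upwards [hS.poisson.ae_eventually_N_add_eq t, hS.ae_monotone_A, hS.G_monotone]
    with ω hN hA hG
  have hA₂ : Monotone fun u : ℝ≥0 ↦ (S.A u ω).2 := fun _ _ huv ↦ (hA (NNReal.coe_le_coe.2 huv)).2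
  change (_ < S.τ₂ L ω) = ∃ n : ℕ, _
  rw [eq_iff_iff, τ₂, lt_iInf_coe_iff_of_monotone (X := fun u ↦ S.X₂ u ω) (hG.add hA₂)]
  simp only [X₂, ← le_sub_iff_add_le]
  refine ⟨fun ⟨n, hn⟩ ↦ ⟨n, hn.trans (sub_le_sub_left (hA₂ le_self_add) L)⟩, fun ⟨n, hn⟩ ↦ ?_⟩
  obtain ⟨m, hNm, hnm⟩ := (hN.and (eventually_ge_atTop n)).exists
  have hle : t + 1 / ((m : ℝ≥0) + 1) ≤ t + 1 / ((n : ℝ≥0) + 1) := by gcongr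
  refine ⟨m, ?_⟩
  rw [A, hNm]
  exact (hG hle).trans hn

end Objects.IsModel

end SecondComponent

section Hazard

theorem intervalIntegrable_indicator_Ici (a c s t : ℝ) :
    IntervalIntegrable ((Set.Ici a).indicator fun _ ↦ c) volume s t := by
  rw [intervalIntegrable_iff]
  exact (intervalIntegrable_iff.1 intervalIntegrable_const).indicator measurableSet_Ici

theorem integral_indicator_Ici {a s t : ℝ} (hsa : s ≤ a) (hat : a ≤ t) (c : ℝ) :
    ∫ u in s..t, (Set.Ici a).indicator (fun _ ↦ c) u = c * (t - a) := by
  have hset : (Set.Ioc s t ∩ Set.Ici a : Set ℝ) =ᵐ[volume] Set.Ioc a t := by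
    have h := (ae_eq_refl (Set.Ioc s t)).inter (Ioi_ae_eq_Ici (μ := volume) (a := a)).symm
    rwa [Set.Ioc_inter_Ioi, sup_of_le_right hsa] at h
  rw [intervalIntegral.integral_of_le (hsa.trans hat), setIntegral_indicator measurableSet_Ici,
    setIntegral_congr_set hset, setIntegral_const, Real.volume_real_Ioc_of_le hat, smul_eq_mul,
    mul_comm]

variable {Ω : Type*} [MeasurableSpace Ω] {P : Measure Ω} {S : Objects Ω} {h lam q : ℝ → ℝ} {L : ℝ}

/-- The conditional probability, given the shocks up to time `t`, that neither a sudden failure of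
the first component nor a fatal shock occurs before `t`. -/
noncomputable def Objects.condSurvival₁₃ (S : Objects Ω) (h q : ℝ → ℝ) (t : ℝ) (ω : Ω) : ℝ :=
  Real.exp (-∫ s in (0 : ℝ)..t, S.X₁ h s ω) * ∏ i ∈ Finset.range (S.N t ω), q (S.T i ω)

namespace Objects.IsModel

theorem ae_integral_X₁ (hS : S.IsModel P h lam q L) (t : ℝ≥0) :
    ∀ᵐ ω ∂P, ∫ s in (0 : ℝ)..t, S.X₁ h s ω =
      cumul h t + ∑ i ∈ Finset.range (S.N t ω), (S.V i ω).1 * (t - S.T i ω) := by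
  filter_upwards [hS.poisson.ae_lt_N_iff, hS.poisson.ae_monotone_N, hS.poisson.pos]
    with ω hN hmono hpos
  have hX : Set.EqOn (fun s ↦ S.X₁ h s ω) (fun s ↦ h s + ∑ i ∈ Finset.range (S.N t ω),
      (Set.Ici (S.T i ω)).indicator (fun _ ↦ (S.V i ω).1) s) (Set.uIcc 0 (t : ℝ)) := by
    intro s hs
    rw [Set.uIcc_of_le t.coe_nonneg] at hs
    have hfilter : (Finset.range (S.N t ω)).filter (S.T · ω ≤ s) = Finset.range (S.N s ω) := by
      ext i
      rw [Finset.mem_filter, Finset.mem_range, Finset.mem_range, ← hN, and_iff_right_of_imp]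
      exact fun hi ↦ hi.trans_le (hmono hs.2)
    simp only [X₁, A, Prod.fst_sum, Set.indicator_apply, Set.mem_Ici, ← Finset.sum_filter, hfilter]
  have hjump (i : ℕ) := intervalIntegrable_indicator_Ici (S.T i ω) (S.V i ω).1 0 t
  have hsum : IntervalIntegrable (fun s ↦ ∑ i ∈ Finset.range (S.N t ω),
      (Set.Ici (S.T i ω)).indicator (fun _ ↦ (S.V i ω).1) s) volume 0 t := by
    simpa only [Finset.sum_fn] using
      IntervalIntegrable.sum (Finset.range (S.N t ω)) fun i _ ↦ hjump i
  rw [intervalIntegral.integral_congr hX, intervalIntegral.integral_add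
    (hS.h_integrable t t.coe_nonneg) hsum, intervalIntegral.integral_finsetSum fun i _ ↦ hjump i]
  refine congrArg (cumul h t + ·) (Finset.sum_congr rfl fun i hi ↦ ?_)
  exact integral_indicator_Ici (hpos i).le ((hN _ _).1 (Finset.mem_range.1 hi)) _

theorem ae_ofReal_condSurvival₁₃_eq (hS : S.IsModel P h lam q L) (t : ℝ≥0) : ∀ᵐ ω ∂P,
    ENNReal.ofReal (S.condSurvival₁₃ h q t ω) = ENNReal.ofReal (Real.exp (-cumul h t)) *
      shockSurvival q 1 t (S.N t ω) (S.T · ω) (S.V · ω) := by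
  filter_upwards [hS.ae_integral_X₁ t, hS.poisson.pos] with ω hX hpos
  rw [condSurvival₁₃, hX, neg_add, Real.exp_add, ENNReal.ofReal_mul (by positivity),
    ENNReal.ofReal_mul (by positivity),
    ENNReal.ofReal_prod_of_nonneg fun i _ ↦ (hS.q_mem _ (hpos i).le).1, shockSurvival,
    Pi.one_apply, mul_one, mul_assoc]

theorem ae_condSurvival₁₃_mem_Icc (hS : S.IsModel P h lam q L) (t : ℝ≥0) :
    ∀ᵐ ω ∂P, S.condSurvival₁₃ h q t ω ∈ Set.Icc 0 1 := by
  filter_upwards [hS.poisson.pos, hS.ae_V_nonneg] with ω hpos hV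
  have hq (i : ℕ) := hS.q_mem _ (hpos i).le
  have hX : 0 ≤ ∫ s in (0 : ℝ)..t, S.X₁ h s ω :=
    intervalIntegral.integral_nonneg t.coe_nonneg fun u hu ↦
      add_nonneg (hS.h_nonneg u hu.1) (Finset.sum_nonneg fun i _ ↦ hV i : 0 ≤ S.A u ω).1
  have hprod := Finset.prod_nonneg fun i (_ : i ∈ Finset.range (S.N t ω)) ↦ (hq i).1
  exact ⟨mul_nonneg (Real.exp_nonneg _) hprod, mul_le_one₀
    (Real.exp_le_one_iff.2 (neg_nonpos.2 hX)) hprod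
    (Finset.prod_le_one (fun i _ ↦ (hq i).1) fun i _ ↦ (hq i).2)⟩

end Objects.IsModel

end Hazard

section Conditioning

theorem measure_eq_setLIntegral_of_condExp_eq_mul {Ω : Type*} {m m₀ : MeasurableSpace Ω}
    {P : Measure Ω} [IsFiniteMeasure P] (hm : m ≤ m₀) {B C : Set Ω} (hB : NullMeasurableSet B P)
    (hC : NullMeasurableSet C P) {Z : Ω → ℝ} (hZ : AEStronglyMeasurable[m] Z P)
    (hZ_int : Integrable Z P) (hZ_nonneg : 0 ≤ᵐ[P] Z) (hBC : P⟦B | m⟧ =ᵐ[P] Z * P⟦C | m⟧) :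
    P B = ∫⁻ ω in C, ENNReal.ofReal (Z ω) ∂P := by
  have hind : Integrable (C.indicator fun _ ↦ (1 : ℝ)) P := (integrable_const 1).indicator₀ hC
  have hmul : Z * C.indicator (fun _ ↦ (1 : ℝ)) = C.indicator Z := by
    ext ω
    simp only [Pi.mul_apply, Set.indicator, mul_ite, mul_one, mul_zero]
  have hZC : Integrable (Z * C.indicator fun _ ↦ (1 : ℝ)) P := hmul ▸ hZ_int.indicator₀ hC
  have hreal : P.real B = ∫ ω in C, Z ω ∂P :=
    calc P.real B = ∫ ω, B.indicator (fun _ ↦ (1 : ℝ)) ω ∂P := by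
          rw [integral_indicator₀ hB, setIntegral_const, smul_eq_mul, mul_one]
      _ = ∫ ω, (P⟦B | m⟧) ω ∂P := (integral_condExp hm).symm
      _ = ∫ ω, (P[Z * C.indicator (fun _ ↦ (1 : ℝ)) | m]) ω ∂P :=
          integral_congr_ae (hBC.trans (condExp_mul_of_aestronglyMeasurable_left hZ hZC hind).symm)
      _ = ∫ ω in C, Z ω ∂P := by
          rw [integral_condExp hm, hmul, integral_indicator₀ hC]
  rw [← ofReal_measureReal, hreal, ofReal_integral_eq_lintegral_ofReal hZ_int.integrableOn
    (ae_restrict_of_ae hZ_nonneg)]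

theorem measurable_sum_range_comp {α E : Type*} [MeasurableSpace α] [MeasurableSpace E]
    [AddCommMonoid E] [MeasurableAdd₂ E] {f : ℕ → α → E} (hf : ∀ i, Measurable (f i)) {ν : α → ℕ}
    (hν : Measurable ν) : Measurable fun a ↦ ∑ i ∈ Finset.range (ν a), f i a :=
  (measurable_from_prod_countable_right (f := fun p : ℕ × α ↦ ∑ i ∈ Finset.range p.1, f i p.2)
    fun n ↦ Finset.measurable_fun_sum (Finset.range n) fun i _ ↦ hf i).comp
      (hν.prodMk measurable_id)

variable {Ω : Type*} [MeasurableSpace Ω] {P : Measure Ω} {S : Objects Ω} {h lam q : ℝ → ℝ} {L : ℝ}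

theorem measurable_τ₃ (hT : ∀ n, Measurable (S.T n)) (hfatal : ∀ n, MeasurableSet (S.fatal n)) :
    Measurable S.τ₃ := by
  classical
  simp only [funext fun ω ↦ Objects.τ₃.eq_1 S ω, iInf_eq_if]
  exact Measurable.iInf fun n ↦ (hT n).ennreal_ofReal.ite (hfatal n) measurable_const

namespace Objects.IsModel

theorem measurable_A (hS : S.IsModel P h lam q L) (t : ℝ) : Measurable (S.A t) :=
  measurable_sum_range_comp hS.V_measurable (measurable_N hS.poisson.measurable t)

theorem history_le (hS : S.IsModel P h lam q L) (t : ℝ≥0) : S.history t ≤ ‹MeasurableSpace Ω› :=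
  iSup₂_le fun s _ ↦
    ((measurable_N hS.poisson.measurable s).prodMk (hS.measurable_A s)).comap_le

theorem nullMeasurableSet_lt_τ₂ (hS : S.IsModel P h lam q L) (t : ℝ≥0) :
    NullMeasurableSet {ω | (t : ℝ≥0∞) < S.τ₂ L ω} P :=
  (measurableSet_exists_le hS.G_measurable
    ((hS.measurable_A t).snd.const_sub L) t).nullMeasurableSet.congr (hS.lt_τ₂_ae_eq t).symm

theorem measure_lt_τ_eq_setLIntegral (hS : S.IsModel P h lam q L) (t : ℝ≥0) :
    P {ω | (t : ℝ≥0∞) < S.τ L ω} = ∫⁻ ω in {ω | (t : ℝ≥0∞) < S.τ₂ L ω},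
      ENNReal.ofReal (S.condSurvival₁₃ h q t ω) ∂P := by
  have := hS.isProbabilityMeasure
  have hm := hS.history_le t
  have hτ₃ := measurable_τ₃ hS.poisson.measurable hS.fatal_measurable
  have hτ : {ω | (t : ℝ≥0∞) < S.τ L ω} =
      {ω | (t : ℝ≥0∞) < S.τ₁ ω ∧ (t : ℝ≥0∞) < S.τ₂ L ω ∧ (t : ℝ≥0∞) < S.τ₃ ω} := by
    simp only [τ, lt_min_iff]
  have hτ_meas : NullMeasurableSet
      {ω | (t : ℝ≥0∞) < S.τ₁ ω ∧ (t : ℝ≥0∞) < S.τ₂ L ω ∧ (t : ℝ≥0∞) < S.τ₃ ω} P :=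
    (measurableSet_lt measurable_const hS.τ₁_measurable).nullMeasurableSet.inter
      ((hS.nullMeasurableSet_lt_τ₂ t).inter
        (measurableSet_lt measurable_const hτ₃).nullMeasurableSet)
  have hcond : P⟦{ω | (t : ℝ≥0∞) < S.τ₁ ω} | S.history t⟧ *
      P⟦{ω | (t : ℝ≥0∞) < S.τ₃ ω} | S.history t⟧ =ᵐ[P] S.condSurvival₁₃ h q t :=
    (hS.τ₁_law t).mul (hS.τ₃_law t)
  have hZ := AEStronglyMeasurable.congr
    (stronglyMeasurable_condExp.mul stronglyMeasurable_condExp).aestronglyMeasurable hcond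
  have hZ01 := hS.ae_condSurvival₁₃_mem_Icc t
  rw [hτ]
  refine measure_eq_setLIntegral_of_condExp_eq_mul hm hτ_meas (hS.nullMeasurableSet_lt_τ₂ t) hZ
    (Integrable.of_mem_Icc 0 1 (hZ.mono hm).aemeasurable hZ01) (hZ01.mono fun _ h ↦ h.1) ?_
  refine (hS.cond_indep t).trans ?_
  filter_upwards [hcond] with ω hω
  rw [Pi.mul_apply, Pi.mul_apply, Pi.mul_apply, ← hω, Pi.mul_apply, mul_right_comm]

theorem indepFun_shockSurvival_G (hS : S.IsModel P h lam q L) (t : ℝ) :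
    (fun ω ↦ (shockSurvival q 1 t (S.N t ω) (S.T · ω) (S.V · ω),
      L - ∑ i ∈ Finset.range (S.N t ω), (S.V i ω).2)) ⟂ᵢ[P] fun ω u ↦ S.G u ω := by
  let ν : (ℕ → ℝ × ℝ × ℝ) → ℕ := fun w ↦ {n | (w n).1 ≤ t}.ncard
  have hν : Measurable ν := (measurable_ncard_setOf_le t).comp (by fun_prop)
  have hsurv : Measurable fun w : ℕ → ℝ × ℝ × ℝ ↦
      shockSurvival q 1 t (ν w) (fun n ↦ (w n).1) (fun n ↦ (w n).2) :=
    measurable_shockSurvival hS.q_measurable measurable_one t hν (by fun_prop) (by fun_prop)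
  have hlevel : Measurable fun w : ℕ → ℝ × ℝ × ℝ ↦ L - ∑ i ∈ Finset.range (ν w), (w i).2.2 :=
    (measurable_sum_range_comp (fun i ↦ by fun_prop) hν).const_sub L
  have hind := hS.G_indep.symm.comp (hsurv.prodMk hlevel) measurable_id
  simp only [Function.comp_def] at hind
  exact hind

theorem measure_lt_τ (hS : S.IsModel P h lam q L) (t : ℝ≥0) :
    P {ω | (t : ℝ≥0∞) < S.τ L ω} = ENNReal.ofReal (Real.exp (-cumul h t)) *
      ∫⁻ ω, shockSurvival q (fun a ↦ levelSurvival P S.G t (L - a)) t (S.N t ω) (S.T · ω) (S.V · ω)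
        ∂P := by
  have := hS.isProbabilityMeasure
  have hN := measurable_N hS.poisson.measurable t
  have hsurv : Measurable fun ω ↦ shockSurvival q 1 t (S.N t ω) (S.T · ω) (S.V · ω) :=
    measurable_shockSurvival hS.q_measurable measurable_one t hN
      (measurable_pi_lambda _ hS.poisson.measurable) (measurable_pi_lambda _ hS.V_measurable)
  have hlevel : Measurable fun ω ↦ L - ∑ i ∈ Finset.range (S.N t ω), (S.V i ω).2 :=
    (measurable_sum_range_comp (fun i ↦ (hS.V_measurable i).snd) hN).const_sub L
  have hA (ω : Ω) : (S.A t ω).2 = ∑ i ∈ Finset.range (S.N t ω), (S.V i ω).2 := Prod.snd_sum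
  calc P {ω | (t : ℝ≥0∞) < S.τ L ω}
      = ∫⁻ ω in {ω | ∃ n : ℕ, S.G (t + 1 / ((n : ℝ≥0) + 1)) ω ≤
            L - ∑ i ∈ Finset.range (S.N t ω), (S.V i ω).2},
          ENNReal.ofReal (Real.exp (-cumul h t)) *
            shockSurvival q 1 t (S.N t ω) (S.T · ω) (S.V · ω) ∂P := by
        simp only [← hA]
        rw [hS.measure_lt_τ_eq_setLIntegral, setLIntegral_congr (hS.lt_τ₂_ae_eq t)]
        exact lintegral_congr_ae (ae_restrict_of_ae (hS.ae_ofReal_condSurvival₁₃_eq t))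
    _ = ENNReal.ofReal (Real.exp (-cumul h t)) *
          ∫⁻ ω, shockSurvival q 1 t (S.N t ω) (S.T · ω) (S.V · ω) *
            levelSurvival P S.G t (L - ∑ i ∈ Finset.range (S.N t ω), (S.V i ω).2) ∂P := by
        rw [lintegral_const_mul' _ _ ENNReal.ofReal_ne_top, setLIntegral_exists_le_of_indepFun
          hS.G_measurable hsurv hlevel (hS.indepFun_shockSurvival_G t)]
    _ = _ := by simp only [shockSurvival, Pi.one_apply, mul_one]

end Objects.IsModel

end Conditioning

end ShockSystem

theorem mainTheorem6_general {Ω : Type*} [MeasurableSpace Ω] {P : Measure Ω}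
    {S : ShockSystem.Objects Ω} {h lam q : ℝ → ℝ} {L : ℝ}
    (hS : S.IsModel P h lam q L) (hh : ShockSystem.IntrinsicNBU₁ h)
    (hG : ShockSystem.IntrinsicNBU₂ S.G P) (hq : AntitoneOn q (Set.Ici 0))
    (hlam : ∀ x y : ℝ, 0 ≤ x → 0 ≤ y →
      ShockSystem.cumul lam x + ShockSystem.cumul lam y ≤ ShockSystem.cumul lam (x + y)) :
    ShockSystem.IsNBU (S.τ L) P := by
  intro s t
  have := hS.isProbabilityMeasure
  have hK (r : ℝ≥0) : Antitone fun a ↦ ShockSystem.levelSurvival P S.G r (L - a) :=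
    fun a b hab ↦ ShockSystem.monotone_levelSurvival r (sub_le_sub_left hab L)
  have hlevel (a b : ℝ) (ha : 0 ≤ a) (hb : 0 ≤ b) :
      ShockSystem.levelSurvival P S.G (s + t) (L - (a + b)) ≤
        ShockSystem.levelSurvival P S.G s (L - a) * ShockSystem.levelSurvival P S.G t (L - b) :=
    (ShockSystem.levelSurvival_add_le_mul hS.G_measurable hS.G_nonneg hS.G_monotone hG s t _).trans
      (mul_le_mul' (hK s (le_add_of_nonneg_right hb)) (hK t (le_add_of_nonneg_left ha)))
  have hshocks := hS.lintegral_shockSurvival_add_le_mul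
    (K := fun a ↦ ShockSystem.levelSurvival P S.G (s + t) (L - a)) hq hlam (hK s) (hK t) hlevel s t
  have hhazard : ENNReal.ofReal (Real.exp (-ShockSystem.cumul h (s + t : ℝ≥0))) ≤
      ENNReal.ofReal (Real.exp (-ShockSystem.cumul h s)) *
        ENNReal.ofReal (Real.exp (-ShockSystem.cumul h t)) := by
    rw [← ENNReal.ofReal_mul (Real.exp_nonneg _)]
    exact ENNReal.ofReal_le_ofReal (hh s t s.coe_nonneg t.coe_nonneg)
  rw [← ENNReal.coe_add, hS.measure_lt_τ, hS.measure_lt_τ, hS.measure_lt_τ, mul_mul_mul_comm]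
  exact mul_le_mul' hhazard hshocks

theorem mainTheorem6 {Ω : Type*} [MeasurableSpace Ω] (P : Measure Ω) [IsProbabilityMeasure P] :
    (∀ G : ℝ≥0 → Ω → ℝ, ShockSystem.IsLevyProcess G P → (∀ t, ∀ᵐ ω ∂P, 0 ≤ G t ω) →
      ShockSystem.IntrinsicNBU₂ G P) ∧
    (∀ (S : ShockSystem.Objects Ω) (h lam q : ℝ → ℝ) (L : ℝ),
      S.IsModel P h lam q L →
      ShockSystem.IntrinsicNBU₁ h →
      ShockSystem.IntrinsicNBU₂ S.G P →
      ((AntitoneOn q (Set.Ici 0) ∧ ∃ c : ℝ, ∀ t, 0 ≤ t → lam t = c) ∨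
        ((∃ c : ℝ, ∀ t, 0 ≤ t → q t = c) ∧
          ∀ x y : ℝ, 0 ≤ x → 0 ≤ y →
            ShockSystem.cumul lam x + ShockSystem.cumul lam y
              ≤ ShockSystem.cumul lam (x + y))) →
      ShockSystem.IsNBU (S.τ L) P) := by
  refine ⟨fun G hG hG_nonneg ↦ hG.intrinsicNBU₂ hG_nonneg, fun S h lam q L hS hh hG hcase ↦ ?_⟩
  rcases hcase with ⟨hq, c, hlam⟩ | ⟨⟨c, hq⟩, hlam⟩
  · refine mainTheorem6_general hS hh hG hq fun x y hx hy ↦ le_of_eq ?_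
    simp only [ShockSystem.cumul_eq_const_mul hlam, hx, hy, add_nonneg, mul_add]
  · exact mainTheorem6_general hS hh hG (fun x hx y hy _ ↦ ((hq y hy).trans (hq x hx).symm).le) hlam
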